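/- Consider the stationary first-come first-served (FCFS) GI/GI/1 queue: packet $n$ ($n\ge 0$) arrives at time $\alpha_n$ and departs at time $\beta_n$, where $\beta_0=0$, $\alpha_{n}=\alpha_{n-1}+G_n$ and $\beta_{n}=\max(\alpha_{n},\beta_{n-1})+H_{n}$ for $n\ge 1$; the interarrival times $G_1,G_2,\dots$ are i.i.d. copies of $G\ge 0$, the service times $H_1,H_2,\dots$ are i.i.d. copies of $H\ge 0$, the system delays are $D_n=\beta_n-\alpha_n$, and $D_0$, $(G_n)_{n\ge1}$, $(H_n)_{n\ge1}$ are independent. Assume that $0<\mathrm E[G]<\infty$, $\mathrm E[H]<\infty$, $\rho:=\mathrm E[H]/\mathrm E[G]<1$, that the queue is stationary, i.e. every $D_n$ has the same law as a random variable $D$, and that the moments $\mathrm E[G^2]$ and $\mathrm E[D]$ are finite. Let the age of information (AoI) be $A_t=t-\alpha_{M_t}$ for $t\ge 0$, where $M_t=\sup\{n\ge 0:\beta_n\le t\}$, and let $\mathrm{Cv}[G]=\sqrt{\mathrm{Var}[G]}/\mathrm E[G]$. Then the mean AoI $$\mathrm E[A]=\lim_{T\to\infty}\frac1T\int_0^T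 A_t\,\mathrm dt$$ exists almost surely as a finite constant, and $$\mathrm E[D]\,\Pr(G\ge \mathrm E[G])+\frac{1+(\mathrm{Cv}[G])^2}{2}\,\mathrm E[G]\;\le\;\mathrm E[A]\;\le\;\mathrm E[D]+\frac{1+(\mathrm{Cv}[G])^2}{2}\,\mathrm E[G].$$ Moreover, for every $n\ge1$, $G_nD_n$ is integrable and $$-\mathrm E[G]\,\mathrm E[D]\,\Pr(G<\mathrm E[G])\;\le\;\mathrm{Cov}[G_n,D_n]\;\le\;0 .$$ -/

import Mathlib

open MeasureTheory ProbabilityTheory Filter Topology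

namespace AgeOfInformation

noncomputable section

/-! ### Sample paths of a single-server FCFS queue

Packets are numbered `0, 1, 2, …`.  `g n` is the time between the arrivals of packets `n` and
`n + 1`, `h n` is the service time of packet `n + 1`, and `d₀` is the system delay of packet `0`.
The time origin is the departure of packet `0`. -/

/-- The arrival time of packet `n`. -/
def arrival (d₀ : ℝ) (g : ℕ → ℝ) : ℕ → ℝ
  | 0 => -d₀
  | n + 1 => arrival d₀ g n + g n

/-- The departure time of packet `n`: the service of packet `n + 1` starts as soon as this packet
has arrived and packet `n` has departed. -/
def departure (d₀ : ℝ) (g h : ℕ → ℝ) : ℕ → ℝ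
  | 0 => 0
  | n + 1 => max (arrival d₀ g (n + 1)) (departure d₀ g h n) + h n

/-- The system delay (waiting time plus service time) of packet `n`. -/
def delay (d₀ : ℝ) (g h : ℕ → ℝ) (n : ℕ) : ℝ :=
  departure d₀ g h n - arrival d₀ g n

/-- The number of the latest packet that has departed by time `t`; since packet `0` departs at
time `0`, this is the number of later packets that have departed by time `t`. -/
def updateCount (d₀ : ℝ) (g h : ℕ → ℝ) (t : ℝ) : ℕ :=
  sSup {n : ℕ | departure d₀ g h n ≤ t}

/-- The age of information at time `t ≥ 0`: the time elapsed since the time-stamp (the arrival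
time) of the latest packet that has departed by time `t`. -/
def age (d₀ : ℝ) (g h : ℕ → ℝ) (t : ℝ) : ℝ :=
  t - arrival d₀ g (updateCount d₀ g h t)

/-! ### The stationary FCFS GI/GI/1 queue -/

variable {Ω : Type*} [MeasurableSpace Ω]

/-- The system delay of packet `n` as a random variable. -/
def Delay (D₀ : Ω → ℝ) (G H : ℕ → Ω → ℝ) (n : ℕ) (ω : Ω) : ℝ :=
  delay (D₀ ω) (fun k => G k ω) (fun k => H k ω) n

/-- The age of information at time `t` as a random variable. -/
def Age (D₀ : Ω → ℝ) (G H : ℕ → Ω → ℝ) (t : ℝ) (ω : Ω) : ℝ :=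
  age (D₀ ω) (fun k => G k ω) (fun k => H k ω) t

/-- The data of a stable stationary FCFS GI/GI/1 queue: i.i.d. interarrival times `G n`, i.i.d.
service times `H n`, and an initial delay `D₀`, mutually independent and nonnegative, with
traffic intensity `E[H] / E[G] < 1`, such that all delays have the same law. -/
structure IsStationaryGIGI1 (P : Measure Ω) (D₀ : Ω → ℝ) (G H : ℕ → Ω → ℝ) : Prop where
  measurable_G : ∀ n, Measurable (G n)
  measurable_H : ∀ n, Measurable (H n)
  measurable_D₀ : Measurable D₀
  nonneg_G : ∀ n, ∀ᵐ ω ∂P, 0 ≤ G n ω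
  nonneg_H : ∀ n, ∀ᵐ ω ∂P, 0 ≤ H n ω
  nonneg_D₀ : ∀ᵐ ω ∂P, 0 ≤ D₀ ω
  iIndepFun_G : iIndepFun G P
  iIndepFun_H : iIndepFun H P
  identDistrib_G : ∀ n, IdentDistrib (G n) (G 0) P P
  identDistrib_H : ∀ n, IdentDistrib (H n) (H 0) P P
  indepFun_G_H : IndepFun (fun ω n => G n ω) (fun ω n => H n ω) P
  indepFun_D₀ : IndepFun D₀ (fun ω => ((fun n => G n ω), (fun n => H n ω))) P
  integrable_G : Integrable (G 0) P
  integrable_H : Integrable (H 0) P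
  mean_G_pos : 0 < P[G 0]
  stable : P[H 0] / P[G 0] < 1
  stationary : ∀ n, IdentDistrib (Delay D₀ G H n) (Delay D₀ G H 0) P P

/-- `a` is the mean age of information: almost surely, the long-run time average of the age
exists and is equal to `a`. -/
def IsMeanAge (P : Measure Ω) (D₀ : Ω → ℝ) (G H : ℕ → Ω → ℝ) (a : ℝ) : Prop :=
  ∀ᵐ ω ∂P,
    (∀ T : ℝ, 0 ≤ T → IntervalIntegrable (fun t => Age D₀ G H t ω) volume 0 T) ∧
    Tendsto (fun T : ℝ => T⁻¹ * ∫ t in (0 : ℝ)..T, Age D₀ G H t ω) atTop (𝓝 a)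

/-- The coefficient of variation: the standard deviation divided by the mean. -/
def coeffVar (P : Measure Ω) (X : Ω → ℝ) : ℝ :=
  √(Var[X; P]) / P[X]

end

end AgeOfInformation

/-! Between the departures of packets n and n + 1 the age grows linearly from D_n to G_n + D_{n+1},
so its integral is G_n²/2 + G_n D_{n+1} plus half the increment of D² (`integral_age_succ`). The
increments telescope. If D_N² = o(N) and the averages of G_n, G_n² and G_n D_{n+1} converge, the
mean age is (E[G²]/2 + E[G_n D_{n+1}]) / E[G] (`tendsto_average_age`), and its bounds are the
covariance bounds divided by E[G].

Only E[D] is assumed finite, so D_N² = o(N) does not come from a second moment. It comes from the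
averages themselves (`tendsto_delay_sq_div`): a delay of order √N persists for a time of order √N,
and would add order N to the sum of G_n D_{n+1} within o(N) packets.

The products G_n D_{n+1} are stationary but dependent, and their law of large numbers is proved
without establishing ergodicity. If the queue is restarted empty K packets earlier, the products
depend on finite windows and the strong law holds along each residue class mod K + 1. The error is a
functional of the stationary path with mean at most E[G] E|D_K - D_K⁰|, where D_K⁰ starts from an
empty queue. This vanishes as K grows, because coupled delays merge in a stable queue and differ by
at most D₀. Hopf's maximal inequality turns a small mean into control of all averages at once, off a
set of small probability.

For the covariance, the service time is independent of G and drops out, leaving E[(G - E[G]) max(D₀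
- G, 0)] with D₀ independent of G. The waiting time decreases in G, which gives the sign; it lies
between 0 and D₀, which gives the lower bound. -/

namespace AgeOfInformation

/-! ### The maximal ergodic inequality -/

section Maximal

variable {Y : Type*}

/-- The running maximum `max_{0 ≤ n ≤ N} ∑_{k < n} f (T^k y)` of the Birkhoff sums of `f`. -/
noncomputable def maxBirkhoff (T : Y → Y) (f : Y → ℝ) : ℕ → Y → ℝ
  | 0 => fun _ => 0
  | N + 1 => fun y => max 0 (f y + maxBirkhoff T f N (T y))

lemma maxBirkhoff_nonneg (T : Y → Y) (f : Y → ℝ) (N : ℕ) (y : Y) : 0 ≤ maxBirkhoff T f N y := by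
  cases N with
  | zero => exact le_rfl
  | succ N => exact le_max_left _ _

lemma maxBirkhoff_le_succ (T : Y → Y) (f : Y → ℝ) (N : ℕ) (y : Y) :
    maxBirkhoff T f N y ≤ maxBirkhoff T f (N + 1) y := by
  induction N generalizing y with
  | zero => exact le_max_left _ _
  | succ N ih =>
    have := ih (T y)
    simp only [maxBirkhoff] at *
    gcongr

lemma birkhoffSum_le_maxBirkhoff (T : Y → Y) (f : Y → ℝ) (N : ℕ) (y : Y) :
    birkhoffSum T f N y ≤ maxBirkhoff T f N y := by
  induction N generalizing y with
  | zero => simp [maxBirkhoff]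
  | succ N ih =>
    rw [birkhoffSum_succ']
    exact le_max_of_le_right (by linarith [ih (T y)])

variable [MeasurableSpace Y] {μ : Measure Y} {T : Y → Y} {f : Y → ℝ}

lemma integrable_maxBirkhoff (hT : MeasurePreserving T μ μ) (hf : Integrable f μ) (N : ℕ) :
    Integrable (maxBirkhoff T f N) μ := by
  induction N with
  | zero => exact integrable_zero _ _ _
  | succ N ih =>
    exact (integrable_zero _ _ _).sup (hf.add (hT.integrable_comp_of_integrable ih))

lemma measurable_maxBirkhoff (hT : Measurable T) (hf : Measurable f) (N : ℕ) :
    Measurable (maxBirkhoff T f N) := by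
  induction N with
  | zero => exact measurable_const
  | succ N ih => exact measurable_const.max (hf.add (ih.comp hT))

/-- **Maximal ergodic theorem** (Hopf), with Garsia's proof. -/
theorem setIntegral_nonneg_of_maxBirkhoff_pos (hT : MeasurePreserving T μ μ) (hfm : Measurable f)
    (hf : Integrable f μ) (N : ℕ) :
    0 ≤ ∫ y in {y | 0 < maxBirkhoff T f N y}, f y ∂μ := by
  cases N with
  | zero => simp [maxBirkhoff]
  | succ N =>
    set M := maxBirkhoff T f (N + 1) with hM
    have hMi : Integrable M μ := integrable_maxBirkhoff hT hf _
    have hMm : Measurable M := measurable_maxBirkhoff hT.measurable hfm _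
    have hMT : Integrable (fun y => M (T y)) μ := hT.integrable_comp_of_integrable hMi
    have hE : MeasurableSet {y | 0 < M y} := measurableSet_lt measurable_const hMm
    have h1 : ∫ y in {y | 0 < M y}, M y ∂μ = ∫ y, M y ∂μ := by
      apply setIntegral_eq_integral_of_forall_compl_eq_zero
      intro y hy
      exact le_antisymm (not_lt.1 hy) (maxBirkhoff_nonneg T f _ y)
    have h2 : ∫ y in {y | 0 < M y}, M (T y) ∂μ ≤ ∫ y, M (T y) ∂μ :=
      setIntegral_le_integral hMT (ae_of_all _ fun y => maxBirkhoff_nonneg T f _ _)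
    have h3 : ∫ y, M (T y) ∂μ = ∫ y, M y ∂μ := by
      have := integral_map (μ := μ) hT.measurable.aemeasurable
        (f := M) (by rw [hT.map_eq]; exact hMi.aestronglyMeasurable)
      rw [← this, hT.map_eq]
    -- `M` vanishes off the set while `M ∘ T` is nonnegative, and the two have the same total
    -- integral.
    calc (0 : ℝ) ≤ ∫ y in {y | 0 < M y}, (M y - M (T y)) ∂μ := by
          rw [integral_sub hMi.integrableOn hMT.integrableOn]; linarith
      _ ≤ ∫ y in {y | 0 < M y}, f y ∂μ := by
          apply setIntegral_mono_on (hMi.sub hMT).integrableOn hf.integrableOn hE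
          intro y hy
          -- Where `M` is positive, the maximum defining it is not attained by 0.
          have h4 : M y ≤ f y + maxBirkhoff T f N (T y) := by
            by_contra! hlt
            have : M y = 0 := by
              rcases max_choice 0 (f y + maxBirkhoff T f N (T y)) with h | h
              · exact h
              · exact absurd (h : M y = _) hlt.ne'
            exact absurd hy (by simp [this])
          have h5 : maxBirkhoff T f N (T y) ≤ M (T y) := maxBirkhoff_le_succ T f N (T y)
          simp only [Pi.sub_apply]
          linarith

/-- **Maximal ergodic inequality**: a weak-type bound for the ergodic maximal function. -/
theorem measure_exists_birkhoffSum_gt_le [IsProbabilityMeasure μ] (hT : MeasurePreserving T μ μ)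
    (hfm : Measurable f) (hf : Integrable f μ) (hf0 : ∀ y, 0 ≤ f y) {l : ℝ} (hl : 0 < l) :
    μ {y | ∃ N : ℕ, l * N < birkhoffSum T f N y} ≤ ENNReal.ofReal ((∫ y, f y ∂μ) / l) := by
  -- The maximal theorem is applied to `f - l`: averages of `f` above `l` are positive Birkhoff sums
  -- of `f - l`.
  have hsub : ∀ N y, birkhoffSum T (fun y => f y - l) N y = birkhoffSum T f N y - l * N := by
    intro N y
    simp [birkhoffSum, Finset.sum_sub_distrib, mul_comm]
  set E : ℕ → Set Y := fun N => {y | 0 < maxBirkhoff T (fun y => f y - l) N y} with hEdef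
  have hmono : Monotone E := monotone_nat_of_le_succ fun N y hy =>
    lt_of_lt_of_le hy (maxBirkhoff_le_succ _ _ _ _)
  have hincl : {y | ∃ N : ℕ, l * N < birkhoffSum T f N y} ⊆ ⋃ N, E N := by
    rintro y ⟨N, hN⟩
    refine Set.mem_iUnion.2 ⟨N, lt_of_lt_of_le ?_ (birkhoffSum_le_maxBirkhoff _ _ _ _)⟩
    rw [hsub]; linarith
  refine (measure_mono hincl).trans ?_
  rw [hmono.measure_iUnion]
  refine iSup_le fun N => ?_
  have hfl : Measurable fun y => f y - l := hfm.sub_const l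
  have hint : Integrable (fun y => f y - l) μ := hf.sub (integrable_const l)
  have hE : MeasurableSet (E N) :=
    measurableSet_lt measurable_const (measurable_maxBirkhoff hT.measurable hfl N)
  have key := setIntegral_nonneg_of_maxBirkhoff_pos hT hfl hint N
  rw [integral_sub hf.integrableOn (integrable_const l).integrableOn] at key
  have h1 : ∫ y in E N, f y ∂μ ≤ ∫ y, f y ∂μ := setIntegral_le_integral hf (ae_of_all _ hf0)
  have h2 : ∫ y in E N, l ∂μ = μ.real (E N) * l := by simp
  change 0 ≤ ∫ y in E N, f y ∂μ - ∫ y in E N, l ∂μ at key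
  rw [← ofReal_measureReal]
  apply ENNReal.ofReal_le_ofReal
  rw [le_div_iff₀ hl]
  linarith

end Maximal

/-! ### Averages of processes -/

section Averages

/-- The inner bound is ⌈(N - r)/L⌉, the number of n < N congruent to r mod L, arranged so that no
natural subtraction truncates. -/
lemma sum_range_eq_sum_residues (p : ℕ → ℝ) {L : ℕ} (hL : 0 < L) (N : ℕ) :
    ∑ n ∈ Finset.range N, p n =
      ∑ r ∈ Finset.range L, ∑ j ∈ Finset.range ((N + (L - 1 - r)) / L), p (r + j * L) := by
  rw [← Finset.sum_fiberwise_of_maps_to (s := Finset.range N) (t := Finset.range L)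
    (g := fun n => n % L) (fun n _ => Finset.mem_range.2 (Nat.mod_lt _ hL))]
  refine Finset.sum_congr rfl fun r hr => ?_
  have hr' := Finset.mem_range.1 hr
  have hiff : ∀ j, j < (N + (L - 1 - r)) / L ↔ r + j * L < N := by
    intro j
    rw [← Nat.succ_le_iff, Nat.le_div_iff_mul_le hL, Nat.succ_mul]
    omega
  symm
  refine Finset.sum_nbij (fun j => r + j * L) ?_ ?_ ?_ (fun _ _ => rfl)
  · intro j hj
    have := (hiff j).1 (Finset.mem_range.1 hj)
    simp [this, Nat.mod_eq_of_lt hr']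
  · intro i _ j _ hij
    exact Nat.eq_of_mul_eq_mul_right hL (Nat.add_left_cancel hij)
  · intro n hn
    simp only [Finset.coe_filter, Finset.mem_range, Set.mem_ofPred_eq] at hn
    have h1 : r + n / L * L = n := by
      rw [← hn.2, mul_comm]; exact Nat.mod_add_div n L
    refine ⟨n / L, ?_, h1⟩
    simp only [Finset.coe_range, Set.mem_Iio]
    rw [hiff, h1]
    exact hn.1

/-- If the averages along every residue class mod `L` converge to `a`, so do the averages. -/
lemma tendsto_average_of_residues {p : ℕ → ℝ} {a : ℝ} {L : ℕ} (hL : 0 < L)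
    (h : ∀ r < L, Tendsto (fun N : ℕ => (∑ j ∈ Finset.range N, p (r + j * L)) / N) atTop (𝓝 a)) :
    Tendsto (fun N : ℕ => (∑ n ∈ Finset.range N, p n) / N) atTop (𝓝 a) := by
  have hL' : (0 : ℝ) < L := by exact_mod_cast hL
  have key : ∀ r ∈ Finset.range L, Tendsto (fun N : ℕ =>
      (∑ j ∈ Finset.range ((N + (L - 1 - r)) / L), p (r + j * L)) / N) atTop (𝓝 (a / L)) := by
    intro r hr
    have hr' := Finset.mem_range.1 hr
    have hc : Tendsto (fun N : ℕ => (N + (L - 1 - r)) / L) atTop atTop :=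
      (Nat.tendsto_div_const_atTop hL.ne').comp (tendsto_add_atTop_nat _)
    have hratio : Tendsto (fun N : ℕ => (((N + (L - 1 - r)) / L : ℕ) : ℝ) / N) atTop
        (𝓝 (1 / L)) := by
      rw [tendsto_iff_norm_sub_tendsto_zero]
      refine squeeze_zero' (Eventually.of_forall fun _ => norm_nonneg _) ?_
        tendsto_one_div_atTop_nhds_zero_nat
      filter_upwards [eventually_gt_atTop 0] with N hN
      have hN' : (0 : ℝ) < N := by exact_mod_cast hN
      have h1 := Nat.div_add_mod (N + (L - 1 - r)) L
      have h2 := Nat.mod_lt (N + (L - 1 - r)) hL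
      set c := (N + (L - 1 - r)) / L
      have h3 : L * c ≤ N + L := by omega
      have h4 : N ≤ L * c + L := by omega
      have h3' : (L : ℝ) * c ≤ N + L := by exact_mod_cast h3
      have h4' : (N : ℝ) ≤ L * c + L := by exact_mod_cast h4
      have h5 : (c : ℝ) / N - 1 / L = (L * c - N) / (N * L) := by field_simp
      rw [h5, Real.norm_eq_abs, abs_div, abs_of_pos (by positivity : (0 : ℝ) < N * L),
        div_le_div_iff₀ (by positivity) hN', one_mul, mul_comm (N : ℝ) L]
      gcongr
      rw [abs_le]
      constructor <;> linarith
    have := ((h r hr').comp hc).mul hratio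
    rw [mul_one_div] at this
    refine this.congr' ?_
    filter_upwards [hc.eventually_gt_atTop 0] with N hN
    have : (((N + (L - 1 - r)) / L : ℕ) : ℝ) ≠ 0 := by exact_mod_cast hN.ne'
    simp only [Function.comp]
    field_simp
  have := tendsto_finsetSum _ key
  simp only [Finset.sum_const, Finset.card_range, nsmul_eq_mul, mul_div_cancel₀ _ hL'.ne'] at this
  refine this.congr fun N => ?_
  rw [← Finset.sum_div, ← sum_range_eq_sum_residues p hL]

/-- The extra `l` absorbs what vanishes in the limit: the first `K` terms and the change of
normalisation from `N` to `N + K`. -/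
lemma eventually_abs_average_sub_le {p : ℕ → ℝ} {a l : ℝ} {K : ℕ} (hl : 0 < l)
    (h : ∀ᶠ N : ℕ in atTop, |(∑ n ∈ Finset.range N, p (n + K)) / N - a| ≤ l) :
    ∀ᶠ N : ℕ in atTop, |(∑ n ∈ Finset.range N, p n) / N - a| ≤ 2 * l := by
  have h0 : Tendsto (fun N : ℕ => (N : ℝ) / (N + K : ℕ)) atTop (𝓝 1) := by
    have := tendsto_natCast_div_add_atTop (𝕜 := ℝ) (K : ℝ)
    simpa using this
  have h1 : Tendsto (fun N : ℕ => (∑ n ∈ Finset.range K, p n) / (N + K : ℕ)) atTop (𝓝 0) :=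
    tendsto_const_nhds.div_atTop
      (tendsto_natCast_atTop_atTop.comp (tendsto_add_atTop_nat K))
  have h2 : Tendsto (fun N : ℕ => (∑ n ∈ Finset.range K, p n) / (N + K : ℕ)
      + a * ((N : ℝ) / (N + K : ℕ) - 1)) atTop (𝓝 0) := by
    have := h1.add ((h0.sub_const 1).const_mul a)
    simpa using this
  rw [← map_add_atTop_eq_nat K, eventually_map]
  filter_upwards [h, (Metric.tendsto_nhds.1 h2 l hl), eventually_gt_atTop 0] with N hN hN2 hN0
  have hN' : (0 : ℝ) < N := by exact_mod_cast hN0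
  have hNK : (0 : ℝ) < (N + K : ℕ) := by positivity
  have hs : ∑ n ∈ Finset.range (N + K), p n
      = ∑ n ∈ Finset.range K, p n + ∑ n ∈ Finset.range N, p (n + K) := by
    rw [add_comm N K, Finset.sum_range_add]
    simp_rw [add_comm]
  have heq : (∑ n ∈ Finset.range (N + K), p n) / ((N + K : ℕ) : ℝ) - a
      = ((∑ n ∈ Finset.range N, p (n + K)) / N - a) * ((N : ℝ) / (N + K : ℕ))
        + ((∑ n ∈ Finset.range K, p n) / (N + K : ℕ) + a * ((N : ℝ) / (N + K : ℕ) - 1)) := by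
    rw [hs]
    field_simp
    ring
  have hr : (N : ℝ) / (N + K : ℕ) ≤ 1 := by
    rw [div_le_one hNK]; push_cast; linarith [(Nat.cast_nonneg K : (0 : ℝ) ≤ K)]
  rw [Real.dist_eq, sub_zero] at hN2
  rw [heq]
  refine (abs_add_le _ _).trans ?_
  rw [abs_mul, abs_of_nonneg (by positivity : 0 ≤ (N : ℝ) / (N + K : ℕ))]
  have := mul_le_mul hN hr (by positivity) hl.le
  linarith

variable {Ω : Type*} [MeasurableSpace Ω] {P : Measure Ω}

/-- A process has almost surely convergent averages if it is approximated by such processes, up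
to errors that satisfy a maximal inequality. -/
theorem ae_tendsto_average_of_approx {p : ℕ → Ω → ℝ} {a : ℝ}
    (h : ∀ ε > 0, ∃ (K : ℕ) (q u : ℕ → Ω → ℝ) (b : ℝ), |b - a| ≤ ε ∧
      (∀ᵐ ω ∂P, Tendsto (fun N : ℕ => (∑ n ∈ Finset.range N, q n ω) / N) atTop (𝓝 b)) ∧
      (∀ᵐ ω ∂P, ∀ n, |p (n + K) ω - q n ω| ≤ u n ω) ∧
      ∀ l > 0, P {ω | ∃ N : ℕ, l * N < ∑ n ∈ Finset.range N, u n ω} ≤ ENNReal.ofReal (ε / l)) :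
    ∀ᵐ ω ∂P, Tendsto (fun N : ℕ => (∑ n ∈ Finset.range N, p n ω) / N) atTop (𝓝 a) := by
  have main : ∀ l : ℝ, 0 < l → ∀ᵐ ω ∂P, ∀ᶠ N : ℕ in atTop,
      |(∑ n ∈ Finset.range N, p n ω) / N - a| ≤ 6 * l := by
    intro l hl
    rw [ae_iff]
    refine le_antisymm (ENNReal.le_of_forall_pos_le_add fun δ hδ _ => ?_) zero_le
    rw [zero_add]
    -- The bound `l` serves for `|b - a|`, and `l * δ` makes the exceptional set of the maximal
    -- inequality have measure at most `δ`.
    obtain ⟨K, q, u, b, hb, hq, hpq, hu⟩ := h (min l (l * δ)) (lt_min hl (by positivity))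
    have hle : P {ω | ∃ N : ℕ, l * N < ∑ n ∈ Finset.range N, u n ω} ≤ δ := by
      refine (hu l hl).trans ?_
      rw [← ENNReal.ofReal_coe_nnreal]
      apply ENNReal.ofReal_le_ofReal
      rw [div_le_iff₀ hl, mul_comm]
      exact min_le_right _ _
    refine le_trans (measure_mono_ae ?_) hle
    filter_upwards [hq, hpq] with ω hqω hpqω hω
    by_contra hgood
    refine hω ?_
    have hgood' : ∀ N : ℕ, ∑ n ∈ Finset.range N, u n ω ≤ l * N := by
      
      intro N
      by_contra! hN
      exact hgood ⟨N, hN⟩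
    -- One `l` each for p to q, for q to b and for b to a; the factor 2 pays for the shift by `K`.
    have : 6 * l = 2 * (3 * l) := by ring
    rw [this]
    refine eventually_abs_average_sub_le (K := K) (by positivity) ?_
    have hq1 : ∀ᶠ N : ℕ in atTop, |(∑ n ∈ Finset.range N, q n ω) / N - b| < l :=
      (Metric.tendsto_nhds.1 hqω l hl)
    filter_upwards [hq1, eventually_gt_atTop 0] with N hN hN0
    have hN' : (0 : ℝ) < N := by exact_mod_cast hN0
    have h1 : |(∑ n ∈ Finset.range N, p (n + K) ω) / N - (∑ n ∈ Finset.range N, q n ω) / N|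
        ≤ l := by
      rw [← sub_div, ← Finset.sum_sub_distrib, abs_div, abs_of_pos hN', div_le_iff₀ hN']
      exact (Finset.abs_sum_le_sum_abs _ _).trans
        ((Finset.sum_le_sum fun n _ => hpqω n).trans (hgood' N))
    have h2 : |b - a| ≤ l := hb.trans (min_le_left _ _)
    have h3 := abs_sub_le ((∑ n ∈ Finset.range N, p (n + K) ω) / N)
      ((∑ n ∈ Finset.range N, q n ω) / N) a
    have h4 := abs_sub_le ((∑ n ∈ Finset.range N, q n ω) / N) b a
    linarith
  have main' := ae_all_iff.2 fun k : ℕ => main (1 / (k + 1 : ℝ)) (by positivity)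
  filter_upwards [main'] with ω hω
  rw [Metric.tendsto_nhds]
  intro ε hε
  obtain ⟨k, hk⟩ := exists_nat_one_div_lt (show 0 < ε / 6 by positivity)
  filter_upwards [hω k] with N hN
  rw [Real.dist_eq]
  linarith

end Averages

/-! ### Independence and shifts -/

section Independence

lemma measurePreserving_prodProdProdComm {α β γ δ : Type*} [MeasurableSpace α] [MeasurableSpace β]
    [MeasurableSpace γ] [MeasurableSpace δ] (a : Measure α) (b : Measure β) (c : Measure γ)
    (d : Measure δ) [SFinite a] [SFinite b] [SFinite c] [SFinite d] :
    MeasurePreserving (fun x : (α × β) × (γ × δ) => ((x.1.1, x.2.1), (x.1.2, x.2.2)))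
      ((a.prod b).prod (c.prod d)) ((a.prod c).prod (b.prod d)) := by
  have h1 := measurePreserving_prodAssoc a b (c.prod d)
  have h2 := (MeasurePreserving.id a).prod (measurePreserving_prodAssoc b c d).symm
  have h3 := (MeasurePreserving.id a).prod
    ((Measure.measurePreserving_swap (μ := b) (ν := c)).prod (MeasurePreserving.id d))
  have h4 := (MeasurePreserving.id a).prod (measurePreserving_prodAssoc c b d)
  have h5 := (measurePreserving_prodAssoc a c (b.prod d)).symm
  exact h5.comp (h4.comp (h3.comp (h2.comp h1)))

variable {Ω : Type*} [MeasurableSpace Ω] {P : Measure Ω} [IsProbabilityMeasure P]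

/-- The hypotheses make the joint law a product of four marginals, whose factors can be regrouped at
will. -/
lemma indepFun_prodMk_prodMk_of_indepFun {α β γ δ : Type*} [MeasurableSpace α] [MeasurableSpace β]
    [MeasurableSpace γ] [MeasurableSpace δ] {A : Ω → α} {B : Ω → β} {C : Ω → γ} {D : Ω → δ}
    (hA : Measurable A) (hB : Measurable B) (hC : Measurable C) (hD : Measurable D)
    (hAB : IndepFun A B P) (hCD : IndepFun C D P)
    (h : IndepFun (fun ω => (A ω, B ω)) (fun ω => (C ω, D ω)) P) :
    IndepFun (fun ω => (A ω, C ω)) (fun ω => (B ω, D ω)) P := by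
  have hAC : IndepFun A C P := h.comp measurable_fst measurable_fst
  have hBD : IndepFun B D P := h.comp measurable_snd measurable_snd
  rw [indepFun_iff_map_prod_eq_prod_map_map (by fun_prop) (by fun_prop)] at hAB hCD h hAC hBD ⊢
  have := Measure.isProbabilityMeasure_map (μ := P) hA.aemeasurable
  have := Measure.isProbabilityMeasure_map (μ := P) hB.aemeasurable
  have := Measure.isProbabilityMeasure_map (μ := P) hC.aemeasurable
  have := Measure.isProbabilityMeasure_map (μ := P) hD.aemeasurable
  have hmp := measurePreserving_prodProdProdComm (P.map A) (P.map B) (P.map C) (P.map D)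
  rw [hAC, hBD, ← hmp.map_eq, ← hAB, ← hCD, ← h, Measure.map_map hmp.measurable (by fun_prop)]
  rfl

/-- The sequence with first term `x.1` and tail `x.2`. -/
def seqCons {α : Type*} (x : α × (ℕ → α)) : ℕ → α
  | 0 => x.1
  | n + 1 => x.2 n

lemma measurable_seqCons {α : Type*} [MeasurableSpace α] :
    Measurable (seqCons : α × (ℕ → α) → ℕ → α) := by
  refine measurable_pi_lambda _ fun n => ?_
  cases n with
  | zero => exact measurable_fst
  | succ n => exact (measurable_pi_apply n).comp measurable_snd

lemma map_seqCons {α : Type*} [MeasurableSpace α] (ν : Measure α) [IsProbabilityMeasure ν] :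
    (ν.prod (Measure.infinitePi fun _ : ℕ => ν)).map seqCons = Measure.infinitePi fun _ => ν := by
  classical
  refine Measure.eq_infinitePi _ fun s t ht => ?_
  obtain ⟨M, hM⟩ : ∃ M : ℕ, s ⊆ Finset.range (M + 1) :=
    ⟨s.sup id, fun i hi => Finset.mem_range.2 (Nat.lt_succ_of_le (Finset.le_sup (f := id) hi))⟩
  -- Padding the cylinder to an initial segment lets its head and tail factor.
  set t' : ℕ → Set α := fun i => if i ∈ s then t i else Set.univ with ht'
  have hmt' : ∀ i, MeasurableSet (t' i) := by
    intro i
    by_cases hi : i ∈ s <;> simp [ht', hi, ht]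
  have hset : seqCons ⁻¹' (Set.pi (s : Set ℕ) t)
      = t' 0 ×ˢ (Set.pi (Finset.range M : Set ℕ) fun i => t' (i + 1)) := by
    ext ⟨x, g⟩
    simp only [Set.mem_preimage, Set.mem_pi, Set.mem_prod, Finset.mem_coe, Finset.mem_range]
    constructor
    · intro h
      refine ⟨?_, fun i _ => ?_⟩
      · by_cases h0 : 0 ∈ s
        · simpa [ht', seqCons, h0] using h 0 h0
        · simp [ht', h0]
      · by_cases h0 : i + 1 ∈ s
        · simpa [ht', seqCons, h0] using h (i + 1) h0
        · simp [ht', h0]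
    · rintro ⟨h0, h1⟩ i hi
      cases i with
      | zero => simpa [ht', seqCons, hi] using h0
      | succ i =>
        have := h1 i (by have := Finset.mem_range.1 (hM hi); omega)
        simpa [ht', seqCons, hi] using this
  rw [Measure.map_apply measurable_seqCons
    (MeasurableSet.pi (Finset.countable_toSet s) fun i _ => ht i), hset, Measure.prod_prod,
    Measure.infinitePi_pi (fun _ => ν) (fun i _ => hmt' (i + 1))]
  have h1 : ∏ i ∈ s, ν (t i) = ∏ i ∈ Finset.range (M + 1), ν (t' i) := by
    rw [← Finset.prod_subset hM]
    · refine Finset.prod_congr rfl fun i hi => by simp [ht', hi]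
    · intro i _ hi
      simp [ht', hi]
  rw [h1, Finset.prod_range_succ', mul_comm]

/-- Splitting off the first coordinate of an i.i.d. sequence. -/
lemma measurePreserving_head_tail {α : Type*} [MeasurableSpace α] (ν : Measure α)
    [IsProbabilityMeasure ν] :
    MeasurePreserving (fun g : ℕ → α => (g 0, fun n => g (n + 1)))
      (Measure.infinitePi fun _ => ν) (ν.prod (Measure.infinitePi fun _ => ν)) := by
  have hm : Measurable (fun g : ℕ → α => (g 0, fun n => g (n + 1))) := by fun_prop
  refine ⟨hm, ?_⟩
  conv_lhs => rw [← map_seqCons ν]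
  rw [Measure.map_map hm measurable_seqCons]
  exact Measure.map_id

end Independence

/-! ### The delay recursion -/

section Delay

@[simp] lemma delay_zero (d₀ : ℝ) (g h : ℕ → ℝ) : delay d₀ g h 0 = d₀ := by
  simp [delay, arrival, departure]

/-- Lindley's recursion. -/
lemma delay_succ (d₀ : ℝ) (g h : ℕ → ℝ) (n : ℕ) :
    delay d₀ g h (n + 1) = max (delay d₀ g h n - g n) 0 + h n := by
  simp only [delay, departure, arrival]
  rcases le_total (arrival d₀ g n + g n) (departure d₀ g h n) with hle | hle
  · rw [max_eq_right hle, max_eq_left (by linarith)]; ring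
  · rw [max_eq_left hle, max_eq_right (by linarith)]; ring

lemma arrival_eq (d₀ : ℝ) (g : ℕ → ℝ) (n : ℕ) :
    arrival d₀ g n = ∑ k ∈ Finset.range n, g k - d₀ := by
  induction n with
  | zero => simp [arrival]
  | succ n ih => rw [arrival, ih, Finset.sum_range_succ]; ring

lemma departure_eq (d₀ : ℝ) (g h : ℕ → ℝ) (n : ℕ) :
    departure d₀ g h n = arrival d₀ g n + delay d₀ g h n := by
  simp [delay]

/-- Markov property: the current delay is all that the queue remembers of its past. -/
lemma delay_add (d₀ : ℝ) (g h : ℕ → ℝ) (n k : ℕ) :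
    delay d₀ g h (n + k) = delay (delay d₀ g h n) (fun i => g (n + i)) (fun i => h (n + i)) k := by
  induction k with
  | zero => simp
  | succ k ih => rw [← add_assoc, delay_succ, delay_succ, ih]

variable {d₀ : ℝ} {g h : ℕ → ℝ}

lemma delay_nonneg (hd : 0 ≤ d₀) (hh : ∀ n, 0 ≤ h n) (n : ℕ) : 0 ≤ delay d₀ g h n := by
  cases n with
  | zero => simpa
  | succ n => rw [delay_succ]; exact add_nonneg (le_max_right _ _) (hh n)

lemma delay_sub_le_delay_succ (hh : ∀ n, 0 ≤ h n) (n : ℕ) :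
    delay d₀ g h n - g n ≤ delay d₀ g h (n + 1) := by
  rw [delay_succ]
  linarith [hh n, le_max_left (delay d₀ g h n - g n) 0]

/-- Measured against arrival times, the delay falls at rate at most one; this makes large delays
persist. -/
lemma delay_sub_sum_le (hh : ∀ n, 0 ≤ h n) (n k : ℕ) :
    delay d₀ g h n - (∑ i ∈ Finset.range (n + k), g i - ∑ i ∈ Finset.range n, g i)
      ≤ delay d₀ g h (n + k) := by
  induction k with
  | zero => simp
  | succ k ih =>
    rw [← add_assoc, Finset.sum_range_succ]
    linarith [delay_sub_le_delay_succ (d₀ := d₀) (g := g) hh (n + k)]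

lemma departure_mono (hh : ∀ n, 0 ≤ h n) : Monotone (departure d₀ g h) :=
  monotone_nat_of_le_succ fun n => by
    rw [departure]
    linarith [hh n, le_max_right (arrival d₀ g (n + 1)) (departure d₀ g h n)]

end Delay

/-! ### The time average of the age along a sample path -/

section SamplePath

variable {d₀ : ℝ} {g h : ℕ → ℝ} {m s c : ℝ}

/-- If the averages of a sequence converge, its terms are `o(n)`. -/
lemma tendsto_div_of_tendsto_average {p : ℕ → ℝ} {a : ℝ}
    (hp : Tendsto (fun N : ℕ => (∑ n ∈ Finset.range N, p n) / N) atTop (𝓝 a)) :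
    Tendsto (fun N : ℕ => p N / N) atTop (𝓝 0) := by
  have h1 := (tendsto_add_atTop_iff_nat 1).2 hp
  have h0 : Tendsto (fun N : ℕ => ((N + 1 : ℕ) : ℝ) / N) atTop (𝓝 1) := by
    have := (tendsto_natCast_div_add_atTop (𝕜 := ℝ) (1 : ℝ)).inv₀ one_ne_zero
    simpa using this
  have := (h1.mul h0).sub hp
  rw [mul_one, sub_self] at this
  refine this.congr' ?_
  filter_upwards [eventually_gt_atTop 0] with N hN
  have : (N : ℝ) ≠ 0 := by positivity
  have : ((N + 1 : ℕ) : ℝ) ≠ 0 := by positivity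
  rw [Finset.sum_range_succ]
  field_simp
  ring

lemma tendsto_sum_atTop (hm : 0 < m)
    (h1 : Tendsto (fun N : ℕ => (∑ n ∈ Finset.range N, g n) / N) atTop (𝓝 m)) :
    Tendsto (fun N : ℕ => ∑ n ∈ Finset.range N, g n) atTop atTop := by
  have := h1.pos_mul_atTop hm tendsto_natCast_atTop_atTop
  refine this.congr' ?_
  filter_upwards [eventually_gt_atTop 0] with N hN
  have : (N : ℝ) ≠ 0 := by positivity
  field_simp

/-- The last packet that arrives less than `x` after packet `N`. -/
lemma exists_sum_lt_le (hm : 0 < m)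
    (h1 : Tendsto (fun N : ℕ => (∑ n ∈ Finset.range N, g n) / N) atTop (𝓝 m)) (N : ℕ) {x : ℝ}
    (hx : 0 < x) :
    ∃ k : ℕ, (∀ j ≤ k, ∑ n ∈ Finset.range (N + j), g n - ∑ n ∈ Finset.range N, g n < x) ∧
      x ≤ ∑ n ∈ Finset.range (N + k + 1), g n - ∑ n ∈ Finset.range N, g n := by
  classical
  have hex : ∃ k : ℕ, x ≤ ∑ n ∈ Finset.range (N + k), g n - ∑ n ∈ Finset.range N, g n := by
    obtain ⟨K, hK⟩ := (tendsto_atTop.1 (tendsto_sum_atTop hm h1)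
      (x + ∑ n ∈ Finset.range N, g n)).exists_forall_of_atTop
    exact ⟨K, by linarith [hK (N + K) (by omega)]⟩
  have hne : Nat.find hex ≠ 0 := by
    intro h0
    have := Nat.find_spec hex
    rw [h0] at this
    simp at this
    linarith
  obtain ⟨k, hk⟩ := Nat.exists_eq_succ_of_ne_zero hne
  refine ⟨k, fun j hj => not_le.1 (Nat.find_min hex (by omega)), ?_⟩
  have := Nat.find_spec hex
  rwa [hk] at this

/-- The delay of packet `n` is `o(√n)`. -/
theorem tendsto_delay_sq_div (hd : 0 ≤ d₀) (hg : ∀ n, 0 ≤ g n) (hh : ∀ n, 0 ≤ h n) (hm : 0 < m)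
    (h1 : Tendsto (fun N : ℕ => (∑ n ∈ Finset.range N, g n) / N) atTop (𝓝 m))
    (h2 : Tendsto (fun N : ℕ => (∑ n ∈ Finset.range N, g n ^ 2) / N) atTop (𝓝 s))
    (h3 : Tendsto (fun N : ℕ => (∑ n ∈ Finset.range N, g n * delay d₀ g h (n + 1)) / N) atTop
      (𝓝 c)) :
    Tendsto (fun N : ℕ => delay d₀ g h N ^ 2 / N) atTop (𝓝 0) := by
  set S : ℕ → ℝ := fun N => ∑ n ∈ Finset.range N, g n with hS
  set C : ℕ → ℝ := fun N => ∑ n ∈ Finset.range N, g n * delay d₀ g h (n + 1) with hC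
  -- If packet `N` had delay at least 2e√N, all packets arriving within the next e√N would have
  -- delay at least e√N. Their contribution to `C` would be about e²N, while there are only o(N) of
  -- them and the averages of `C` converge.
  have key : ∀ e : ℝ, 0 < e → ∀ᶠ N : ℕ in atTop, delay d₀ g h N < 2 * (e * √N) := by
    intro e he
    have hex : ∀ N : ℕ, ∃ k : ℕ, 0 < N → ((∀ j ≤ k, S (N + j) - S N < e * √N) ∧
        e * √N ≤ S (N + k + 1) - S N) := by
      intro N
      by_cases hN : 0 < N
      · obtain ⟨k, hk⟩ := exists_sum_lt_le hm h1 N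
          (show 0 < e * √N by have : (0 : ℝ) < N := by exact_mod_cast hN
                              positivity)
        exact ⟨k, fun _ => hk⟩
      · exact ⟨0, fun h => absurd h hN⟩
    choose k hk using hex
    have hφ : Tendsto (fun N => N + k N) atTop atTop :=
      tendsto_atTop_mono (fun N => Nat.le_add_right N (k N)) tendsto_id
    have hsq : Tendsto (fun N : ℕ => 1 / √(N : ℝ)) atTop (𝓝 0) :=
      tendsto_const_nhds.div_atTop
        (Real.tendsto_sqrt_atTop.comp tendsto_natCast_atTop_atTop)
    have hSφ : Tendsto (fun N => (S (N + k N) - S N) / N) atTop (𝓝 0) := by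
      refine squeeze_zero' (g := fun N : ℕ => e * (1 / √(N : ℝ))) ?_ ?_
        (by simpa using hsq.const_mul e)
      · filter_upwards with N
        have : S N ≤ S (N + k N) := Finset.sum_le_sum_of_subset_of_nonneg
          (Finset.range_mono (by omega)) (fun i _ _ => hg i)
        exact div_nonneg (by linarith) (Nat.cast_nonneg _)
      · filter_upwards [eventually_gt_atTop 0] with N hN
        have hN' : (0 : ℝ) < N := by exact_mod_cast hN
        have h4 := (hk N hN).1 (k N) le_rfl
        have h5 : √(N : ℝ) * √N = N := Real.mul_self_sqrt hN'.le
        have h6 : 0 < √(N : ℝ) := Real.sqrt_pos.2 hN'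
        rw [div_le_iff₀ hN', mul_one_div, div_mul_eq_mul_div, le_div_iff₀ h6]
        calc (S (N + k N) - S N) * √N ≤ e * √N * √N := by gcongr
          _ = e * N := by rw [mul_assoc, h5]
    have hSφ' : Tendsto (fun N => S (N + k N) / N) atTop (𝓝 m) := by
      have := hSφ.add h1
      rw [zero_add] at this
      refine this.congr fun N => ?_
      simp only [hS]; ring
    -- `S (N + k N)` is asymptotic both to m N and to m (N + k N), hence `k N` is o(N).
    have hratio : Tendsto (fun N : ℕ => ((N + k N : ℕ) : ℝ) / N) atTop (𝓝 1) := by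
      have := hSφ'.div (h1.comp hφ) hm.ne'
      rw [div_self hm.ne'] at this
      refine this.congr' ?_
      filter_upwards [(h1.comp hφ).eventually_ne hm.ne', eventually_gt_atTop 0] with N hN hN0
      simp only [Function.comp, Pi.div_apply] at hN ⊢
      change S (N + k N) / _ ≠ 0 at hN
      change S (N + k N) / N / (S (N + k N) / _) = _
      have h7 : S (N + k N) ≠ 0 := fun h => hN (by rw [h, zero_div])
      have : ((N + k N : ℕ) : ℝ) ≠ 0 := by positivity
      field_simp
    have hCφ : Tendsto (fun N => (C (N + k N) - C N) / N) atTop (𝓝 0) := by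
      have := ((h3.comp hφ).mul hratio).sub h3
      rw [mul_one, sub_self] at this
      refine this.congr' ?_
      filter_upwards [eventually_gt_atTop 0] with N hN
      have : ((N + k N : ℕ) : ℝ) ≠ 0 := by positivity
      simp only [Function.comp, hC]
      field_simp
    -- The gap that crosses e√N is left out of the sum; convergence of the averages of g² makes it
    -- o(√N).
    have hgφ : Tendsto (fun N : ℕ => g (N + k N) / √N) atTop (𝓝 0) := by
      have := (((tendsto_div_of_tendsto_average h2).comp hφ).mul hratio).sqrt
      rw [mul_one, Real.sqrt_zero] at this
      refine this.congr' ?_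
      filter_upwards [eventually_gt_atTop 0] with N hN
      have : ((N + k N : ℕ) : ℝ) ≠ 0 := by positivity
      simp only [Function.comp]
      rw [div_mul_div_cancel₀ this, Real.sqrt_div (sq_nonneg _), Real.sqrt_sq (hg _)]
    have hlim : Tendsto (fun N : ℕ => e * (e - g (N + k N) / √N) - (C (N + k N) - C N) / N) atTop
        (𝓝 (e * (e - 0) - 0)) := ((hgφ.const_sub e).const_mul e).sub hCφ
    have hpos : 0 < e * (e - 0) - 0 := by simp; positivity
    filter_upwards [hlim.eventually_const_lt hpos, eventually_gt_atTop 0] with N hN hN0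
    by_contra! hD
    have hN' : (0 : ℝ) < N := by exact_mod_cast hN0
    have h6 : 0 < √(N : ℝ) := Real.sqrt_pos.2 hN'
    have h5 : √(N : ℝ) * √N = N := Real.mul_self_sqrt hN'.le
    obtain ⟨hk1, hk2⟩ := hk N hN0
    have hge : ∀ j ≤ k N, e * √N ≤ delay d₀ g h (N + j) := by
      intro j hj
      have h7 : delay d₀ g h N - (S (N + j) - S N) ≤ delay d₀ g h (N + j) :=
        delay_sub_sum_le hh N j
      have h8 := hk1 j hj
      linarith
    have hsum : e * √N * (S (N + k N) - S N) ≤ C (N + k N) - C N := by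
      simp only [hS, hC, Finset.sum_range_add, add_sub_cancel_left]
      rw [Finset.mul_sum]
      refine Finset.sum_le_sum fun j hj => ?_
      rw [mul_comm]
      exact mul_le_mul_of_nonneg_left (hge (j + 1) (Finset.mem_range.1 hj)) (hg _)
    have h9 : S (N + k N + 1) = S (N + k N) + g (N + k N) := Finset.sum_range_succ _ _
    have h10 : e * √N * (e * √N - g (N + k N)) ≤ C (N + k N) - C N :=
      le_trans (mul_le_mul_of_nonneg_left (by linarith) (by positivity)) hsum
    have h11 : e * (e - g (N + k N) / √N) ≤ (C (N + k N) - C N) / N := by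
      rw [le_div_iff₀ hN']
      refine le_of_eq_of_le ?_ h10
      generalize √(N : ℝ) = r at h5 h6
      rw [← h5]
      field_simp
    linarith
  have h0 : ∀ N, 0 ≤ delay d₀ g h N := delay_nonneg hd hh
  rw [Metric.tendsto_nhds]
  intro ε hε
  filter_upwards [key (√ε / 2) (by positivity), eventually_gt_atTop 0] with N hN hN0
  have hN' : (0 : ℝ) < N := by exact_mod_cast hN0
  rw [Real.dist_eq, sub_zero, abs_of_nonneg (by positivity), div_lt_iff₀ hN']
  have h1 : delay d₀ g h N < √ε * √N := by linarith
  calc delay d₀ g h N ^ 2 < (√ε * √N) ^ 2 := by gcongr; exact h0 N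
    _ = ε * N := by rw [mul_pow, Real.sq_sqrt hε.le, Real.sq_sqrt hN'.le]

lemma tendsto_departure_div (hd : 0 ≤ d₀) (hh : ∀ n, 0 ≤ h n)
    (h1 : Tendsto (fun N : ℕ => (∑ n ∈ Finset.range N, g n) / N) atTop (𝓝 m))
    (hD : Tendsto (fun N : ℕ => delay d₀ g h N ^ 2 / N) atTop (𝓝 0)) :
    Tendsto (fun N : ℕ => departure d₀ g h N / N) atTop (𝓝 m) := by
  have h2 : Tendsto (fun N : ℕ => delay d₀ g h N / N) atTop (𝓝 0) := by
    have h3 : Tendsto (fun N : ℕ => 1 / √(N : ℝ)) atTop (𝓝 0) :=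
      tendsto_const_nhds.div_atTop
        (Real.tendsto_sqrt_atTop.comp tendsto_natCast_atTop_atTop)
    have := hD.sqrt.mul h3
    rw [mul_zero] at this
    refine this.congr' ?_
    filter_upwards [eventually_gt_atTop 0] with N hN
    have hN' : (0 : ℝ) < N := by exact_mod_cast hN
    rw [Real.sqrt_div (sq_nonneg _), Real.sqrt_sq (delay_nonneg hd hh N), div_mul_div_comm,
      mul_one, Real.mul_self_sqrt hN'.le]
  have h4 : Tendsto (fun N : ℕ => d₀ / (N : ℝ)) atTop (𝓝 0) :=
    tendsto_const_nhds.div_atTop tendsto_natCast_atTop_atTop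
  have := (h1.sub h4).add h2
  rw [sub_zero, add_zero] at this
  refine this.congr fun N => ?_
  rw [departure_eq, arrival_eq]
  ring

lemma updateCount_eq (hh : ∀ n, 0 ≤ h n) {n : ℕ} {t : ℝ} (h1 : departure d₀ g h n ≤ t)
    (h2 : t < departure d₀ g h (n + 1)) : updateCount d₀ g h t = n := by
  have hset : {k : ℕ | departure d₀ g h k ≤ t} = Set.Iic n := by
    ext k
    simp only [Set.mem_ofPred_eq, Set.mem_Iic]
    constructor
    · intro hk
      by_contra! hlt
      linarith [departure_mono (d₀ := d₀) (g := g) hh (show n + 1 ≤ k from hlt)]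
    · intro hk
      exact (departure_mono hh hk).trans h1
  rw [updateCount, hset]
  exact csSup_Iic

/-- If departures tend to infinity, each time `t ≥ 0` lies in an interval between departures. -/
lemma updateCount_spec (hh : ∀ n, 0 ≤ h n) (hβ : Tendsto (departure d₀ g h) atTop atTop) {t : ℝ}
    (ht : 0 ≤ t) : departure d₀ g h (updateCount d₀ g h t) ≤ t ∧
      t < departure d₀ g h (updateCount d₀ g h t + 1) := by
  classical
  have hex : ∃ n, t < departure d₀ g h n := (hβ.eventually_gt_atTop t).exists
  have hne : Nat.find hex ≠ 0 := by
    intro h0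
    have := Nat.find_spec hex
    rw [h0, departure] at this
    linarith
  obtain ⟨n, hn⟩ := Nat.exists_eq_succ_of_ne_zero hne
  have h1 : departure d₀ g h n ≤ t := not_lt.1 (Nat.find_min hex (by omega))
  have h2 : t < departure d₀ g h (n + 1) := by
    have := Nat.find_spec hex
    rwa [hn] at this
  rw [updateCount_eq hh h1 h2]
  exact ⟨h1, h2⟩

lemma tendsto_updateCount (hh : ∀ n, 0 ≤ h n) (hβ : Tendsto (departure d₀ g h) atTop atTop) :
    Tendsto (updateCount d₀ g h) atTop atTop := by
  refine tendsto_atTop.2 fun n => ?_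
  filter_upwards [eventually_ge_atTop (departure d₀ g h n), eventually_ge_atTop 0] with t ht ht0
  by_contra! hlt
  have := (updateCount_spec hh hβ ht0).2
  linarith [departure_mono (d₀ := d₀) (g := g) hh (show updateCount d₀ g h t + 1 ≤ n from hlt)]

lemma age_nonneg (hd : 0 ≤ d₀) (hh : ∀ n, 0 ≤ h n)
    (hβ : Tendsto (departure d₀ g h) atTop atTop) {t : ℝ} (ht : 0 ≤ t) : 0 ≤ age d₀ g h t := by
  have h1 := (updateCount_spec hh hβ ht).1
  rw [departure_eq] at h1
  have := delay_nonneg (g := g) hd hh (updateCount d₀ g h t)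
  rw [age]
  linarith

lemma age_ae_eq (hh : ∀ n, 0 ≤ h n) (n : ℕ) :
    (fun t => t - arrival d₀ g n) =ᵐ[volume.restrict
      (Set.uIoc (departure d₀ g h n) (departure d₀ g h (n + 1)))] age d₀ g h := by
  -- The age jumps at the right endpoint, so the formula holds on `Ico` and transfers to `Ioc` up to
  -- a null set.
  rw [Set.uIoc_of_le (departure_mono hh n.le_succ), ← restrict_Ico_eq_restrict_Ioc]
  filter_upwards [ae_restrict_mem measurableSet_Ico] with t ht
  rw [age, updateCount_eq hh ht.1 ht.2]

lemma intervalIntegrable_age_succ (hh : ∀ n, 0 ≤ h n) (n : ℕ) :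
    IntervalIntegrable (age d₀ g h) volume (departure d₀ g h n) (departure d₀ g h (n + 1)) :=
  (Continuous.intervalIntegrable (by fun_prop) _ _ :
    IntervalIntegrable (fun t => t - arrival d₀ g n) volume _ _).congr_ae (age_ae_eq hh n)

/-- The area of a trapezoid of slope one, ((g_n + D_{n+1})² - D_n²)/2, expanded so that the squared
delays telescope. -/
lemma integral_age_succ (hh : ∀ n, 0 ≤ h n) (n : ℕ) :
    ∫ t in departure d₀ g h n..departure d₀ g h (n + 1), age d₀ g h t =
      g n ^ 2 / 2 + g n * delay d₀ g h (n + 1)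
        + (delay d₀ g h (n + 1) ^ 2 - delay d₀ g h n ^ 2) / 2 := by
  rw [← intervalIntegral.integral_congr_ae_restrict (age_ae_eq hh n),
    intervalIntegral.integral_sub (by simp) (by simp), integral_id,
    intervalIntegral.integral_const, departure_eq, departure_eq, arrival]
  simp only [smul_eq_mul]
  ring

lemma integral_age_departure (hh : ∀ n, 0 ≤ h n) (N : ℕ) :
    IntervalIntegrable (age d₀ g h) volume 0 (departure d₀ g h N) ∧
    ∫ t in (0 : ℝ)..departure d₀ g h N, age d₀ g h t =
      (∑ n ∈ Finset.range N, g n ^ 2) / 2 + ∑ n ∈ Finset.range N, g n * delay d₀ g h (n + 1)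
        + (delay d₀ g h N ^ 2 - d₀ ^ 2) / 2 := by
  induction N with
  | zero => simp [departure]
  | succ N ih =>
    refine ⟨ih.1.trans (intervalIntegrable_age_succ hh N), ?_⟩
    rw [← intervalIntegral.integral_add_adjacent_intervals ih.1 (intervalIntegrable_age_succ hh N),
      ih.2, integral_age_succ hh, Finset.sum_range_succ, Finset.sum_range_succ]
    ring

/-- The time average of the age along a sample path with convergent averages. -/
theorem tendsto_average_age (hd : 0 ≤ d₀) (hg : ∀ n, 0 ≤ g n) (hh : ∀ n, 0 ≤ h n) (hm : 0 < m)
    (h1 : Tendsto (fun N : ℕ => (∑ n ∈ Finset.range N, g n) / N) atTop (𝓝 m))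
    (h2 : Tendsto (fun N : ℕ => (∑ n ∈ Finset.range N, g n ^ 2) / N) atTop (𝓝 s))
    (h3 : Tendsto (fun N : ℕ => (∑ n ∈ Finset.range N, g n * delay d₀ g h (n + 1)) / N) atTop
      (𝓝 c)) :
    (∀ T : ℝ, 0 ≤ T → IntervalIntegrable (age d₀ g h) volume 0 T) ∧
      Tendsto (fun T : ℝ => T⁻¹ * ∫ t in (0 : ℝ)..T, age d₀ g h t) atTop
        (𝓝 ((s / 2 + c) / m)) := by
  have hD := tendsto_delay_sq_div hd hg hh hm h1 h2 h3
  have hβ := tendsto_departure_div hd hh h1 hD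
  have hβ' : Tendsto (departure d₀ g h) atTop atTop := by
    refine (hβ.pos_mul_atTop hm tendsto_natCast_atTop_atTop).congr' ?_
    filter_upwards [eventually_gt_atTop 0] with N hN
    have : (N : ℝ) ≠ 0 := by positivity
    field_simp
  have hint : ∀ T : ℝ, 0 ≤ T → IntervalIntegrable (age d₀ g h) volume 0 T := by
    intro T hT
    refine (integral_age_departure (d₀ := d₀) (g := g) hh (updateCount d₀ g h T + 1)).1.mono_set ?_
    have := (updateCount_spec hh hβ' hT).2.le
    rw [Set.uIcc_of_le hT, Set.uIcc_of_le (hT.trans this)]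
    exact Set.Icc_subset_Icc_right this
  refine ⟨hint, ?_⟩
  set M := updateCount d₀ g h with hMdef
  have hM : Tendsto M atTop atTop := tendsto_updateCount hh hβ'
  have hM1 : Tendsto (fun T => M T + 1) atTop atTop := (tendsto_add_atTop_nat 1).comp hM
  set I : ℕ → ℝ := fun N => ∫ t in (0 : ℝ)..departure d₀ g h N, age d₀ g h t with hI
  have hIlim : Tendsto (fun N : ℕ => I N / N) atTop (𝓝 (s / 2 + c)) := by
    have h4 : Tendsto (fun N : ℕ => d₀ ^ 2 / (N : ℝ)) atTop (𝓝 0) :=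
      tendsto_const_nhds.div_atTop tendsto_natCast_atTop_atTop
    have := ((h2.div_const 2).add h3).add ((hD.sub h4).div_const 2)
    rw [sub_zero, zero_div, add_zero] at this
    refine this.congr fun N => ?_
    simp only [hI, (integral_age_departure (d₀ := d₀) (g := g) hh N).2]
    ring
  have hr : Tendsto (fun T => ((M T + 1 : ℕ) : ℝ) / M T) atTop (𝓝 1) := by
    have := (tendsto_natCast_div_add_atTop (𝕜 := ℝ) (1 : ℝ)).inv₀ one_ne_zero
    have := (this.comp hM)
    simpa [Function.comp_def] using this
  have hT : Tendsto (fun T => T / M T) atTop (𝓝 m) := by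
    have hup : Tendsto (fun T => departure d₀ g h (M T + 1) / (M T + 1 : ℕ)
        * (((M T + 1 : ℕ) : ℝ) / M T)) atTop (𝓝 m) := by
      simpa using (hβ.comp hM1).mul hr
    refine tendsto_of_tendsto_of_tendsto_of_le_of_le' (hβ.comp hM) hup ?_ ?_
    · filter_upwards [eventually_ge_atTop 0] with T hT
      simp only [Function.comp]
      gcongr
      exact (updateCount_spec hh hβ' hT).1
    · filter_upwards [eventually_ge_atTop 0] with T hT
      rw [div_mul_div_cancel₀ (by positivity)]
      gcongr
      exact (updateCount_spec hh hβ' hT).2.le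
  -- As the age is nonnegative, the integral up to `T` lies between those up to the departures
  -- surrounding `T`.
  have hlow : Tendsto (fun T => I (M T) / M T / (T / M T)) atTop (𝓝 ((s / 2 + c) / m)) :=
    (hIlim.comp hM).div hT hm.ne'
  have hupp : Tendsto (fun T => I (M T + 1) / (M T + 1 : ℕ) * (((M T + 1 : ℕ) : ℝ) / M T)
      / (T / M T)) atTop (𝓝 ((s / 2 + c) / m)) := by
    have := ((hIlim.comp hM1).mul hr).div hT hm.ne'
    rw [mul_one] at this
    exact this
  have hmono : ∀ a b : ℝ, 0 ≤ a → a ≤ b →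
      ∫ t in (0 : ℝ)..a, age d₀ g h t ≤ ∫ t in (0 : ℝ)..b, age d₀ g h t := by
    intro a b ha hab
    refine intervalIntegral.integral_mono_interval le_rfl ha hab ?_ (hint b (ha.trans hab))
    filter_upwards [ae_restrict_mem measurableSet_Ioc] with t ht
    exact age_nonneg hd hh hβ' ht.1.le
  have hdep0 : ∀ n, 0 ≤ departure d₀ g h n := fun n => departure_mono hh (Nat.zero_le n)
  refine tendsto_of_tendsto_of_tendsto_of_le_of_le' hlow hupp ?_ ?_
  · filter_upwards [eventually_gt_atTop 0, hM.eventually_gt_atTop 0] with T hT0 hMT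
    have : (M T : ℝ) ≠ 0 := by positivity
    rw [div_div_div_cancel_right₀ this, div_eq_inv_mul]
    gcongr
    exact hmono _ _ (hdep0 _) (updateCount_spec hh hβ' hT0.le).1
  · filter_upwards [eventually_gt_atTop 0, hM.eventually_gt_atTop 0] with T hT0 hMT
    have : (M T : ℝ) ≠ 0 := by positivity
    rw [div_mul_div_cancel₀ (by positivity), div_div_div_cancel_right₀ this, div_eq_inv_mul]
    gcongr
    exact hmono _ _ hT0.le (updateCount_spec hh hβ' hT0.le).2.le

end SamplePath

/-! ### Coupling of delays -/

section Coupling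

variable {d d' : ℝ} {g h : ℕ → ℝ}

lemma delay_congr {g' h' : ℕ → ℝ} {n : ℕ} (hg : ∀ i < n, g i = g' i) (hh : ∀ i < n, h i = h' i) :
    delay d g h n = delay d g' h' n := by
  induction n with
  | zero => simp
  | succ n ih =>
    rw [delay_succ, delay_succ, ih (fun i hi => hg i (by omega)) (fun i hi => hh i (by omega)),
      hg n (by omega), hh n (by omega)]

lemma delay_mono_left (hdd : d ≤ d') (n : ℕ) : delay d g h n ≤ delay d' g h n := by
  induction n with
  | zero => simpa
  | succ n ih => rw [delay_succ, delay_succ]; gcongr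

lemma abs_delay_succ_sub_le (n : ℕ) :
    |delay d g h (n + 1) - delay d' g h (n + 1)| ≤ |delay d g h n - delay d' g h n| := by
  rw [delay_succ, delay_succ, add_sub_add_right_eq_sub]
  refine (abs_max_sub_max_le_abs _ _ _).trans_eq ?_
  rw [sub_sub_sub_cancel_right]

lemma abs_delay_sub_le (n : ℕ) : |delay d g h n - delay d' g h n| ≤ |d - d'| := by
  induction n with
  | zero => simp
  | succ n ih => exact (abs_delay_succ_sub_le n).trans ih

/-- In a stable queue, the influence of the initial delay disappears. -/
lemma eventually_delay_eq (hd : 0 ≤ d) (hh : ∀ n, 0 ≤ h n)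
    (hgh : Tendsto (fun N : ℕ => ∑ n ∈ Finset.range N, (g n - h n)) atTop atTop) :
    ∀ᶠ n in atTop, delay d g h n = delay 0 g h n := by
  -- Some packet finds the queue empty: otherwise Lindley's recursion stays linear and the delay
  -- tends to -∞. From then on the two coupled delays coincide.
  have hex : ∃ n, delay d g h n ≤ g n := by
    by_contra! hlt
    have hsum : ∀ N, delay d g h N = d - ∑ n ∈ Finset.range N, (g n - h n) := by
      intro N
      induction N with
      | zero => simp
      | succ N ih =>
        rw [delay_succ, max_eq_left (by linarith [hlt N]), Finset.sum_range_succ, ih]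
        ring
    obtain ⟨N, hN⟩ := (hgh.eventually_gt_atTop d).exists
    linarith [hsum N, delay_nonneg (g := g) hd hh N]
  obtain ⟨n, hn⟩ := hex
  have heq : delay d g h (n + 1) = delay 0 g h (n + 1) := by
    have := delay_mono_left (g := g) (h := h) hd n
    rw [delay_succ, delay_succ, max_eq_right (by linarith), max_eq_right (by linarith)]
  filter_upwards [eventually_ge_atTop (n + 1)] with N hN
  obtain ⟨k, rfl⟩ := Nat.exists_eq_add_of_le hN
  rw [delay_add, heq, ← delay_add]

end Coupling

/-! ### The path space -/

section PathSpace

/-- One step of the queue: the delay of the next packet, and the future after it. -/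
noncomputable def lindleyStep (y : ℝ × (ℕ → ℝ) × (ℕ → ℝ)) : ℝ × (ℕ → ℝ) × (ℕ → ℝ) :=
  (max (y.1 - y.2.1 0) 0 + y.2.2 0, (fun n => y.2.1 (n + 1)), fun n => y.2.2 (n + 1))

lemma lindleyStep_iterate (n : ℕ) (y : ℝ × (ℕ → ℝ) × (ℕ → ℝ)) :
    lindleyStep^[n] y =
      (delay y.1 y.2.1 y.2.2 n, (fun i => y.2.1 (n + i)), fun i => y.2.2 (n + i)) := by
  induction n with
  | zero => simp
  | succ n ih =>
    rw [Function.iterate_succ_apply', ih, lindleyStep, delay_succ]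
    simp only [add_zero, Prod.mk.injEq, true_and]
    exact ⟨funext fun i => congrArg y.2.1 (by omega), funext fun i => congrArg y.2.2 (by omega)⟩

lemma measurable_delay (n : ℕ) :
    Measurable fun y : ℝ × (ℕ → ℝ) × (ℕ → ℝ) => delay y.1 y.2.1 y.2.2 n := by
  induction n with
  | zero => simpa using measurable_fst
  | succ n ih => simp only [delay_succ]; fun_prop

/-- The first interarrival and service times are split off and consumed with the delay; the new
delay has law `δ` and is independent of the tails, which are again i.i.d. -/
lemma measurePreserving_lindleyStep {δ ν η : Measure ℝ} [IsProbabilityMeasure δ]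
    [IsProbabilityMeasure ν] [IsProbabilityMeasure η]
    (hδ : (δ.prod (ν.prod η)).map (fun x => max (x.1 - x.2.1) 0 + x.2.2) = δ) :
    MeasurePreserving lindleyStep
      (δ.prod ((Measure.infinitePi fun _ => ν).prod (Measure.infinitePi fun _ => η)))
      (δ.prod ((Measure.infinitePi fun _ => ν).prod (Measure.infinitePi fun _ => η))) := by
  have e1 := (MeasurePreserving.id δ).prod
    ((measurePreserving_head_tail ν).prod (measurePreserving_head_tail η))
  have e2 := (MeasurePreserving.id δ).prod (measurePreserving_prodProdProdComm ν
    (Measure.infinitePi fun _ : ℕ => ν) η (Measure.infinitePi fun _ : ℕ => η))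
  have e3 := (measurePreserving_prodAssoc δ (ν.prod η)
    ((Measure.infinitePi fun _ : ℕ => ν).prod (Measure.infinitePi fun _ : ℕ => η))).symm
  have hf : MeasurePreserving (fun x : ℝ × ℝ × ℝ => max (x.1 - x.2.1) 0 + x.2.2)
    (δ.prod (ν.prod η)) δ := ⟨by fun_prop, hδ⟩
  have e4 := hf.prod (MeasurePreserving.id
    ((Measure.infinitePi fun _ : ℕ => ν).prod (Measure.infinitePi fun _ : ℕ => η)))
  exact e4.comp (e3.comp (e2.comp e1))

/-- Extension by zero of a family indexed by a finite set. -/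
noncomputable def extendZero (S : Finset ℕ) (x : S → ℝ) (i : ℕ) : ℝ :=
  if hi : i ∈ S then x ⟨i, hi⟩ else 0

lemma measurable_extendZero (S : Finset ℕ) : Measurable (extendZero S) := by
  refine measurable_pi_lambda _ fun i => ?_
  by_cases hi : i ∈ S <;> simp only [extendZero, hi, dite_true, dite_false] <;> fun_prop

lemma extendZero_of_mem {S : Finset ℕ} {i : ℕ} (hi : i ∈ S) (g : ℕ → ℝ) :
    extendZero S (fun j : S => g j) i = g i := by simp [extendZero, hi]

end PathSpace

/-! ### The stationary queue -/

section Stationary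

variable {Ω : Type*} {D₀ : Ω → ℝ} {G H : ℕ → Ω → ℝ}

/-- The initial delay, the interarrival times and the service times, as a point of the path
space. -/
def queuePath (D₀ : Ω → ℝ) (G H : ℕ → Ω → ℝ) (ω : Ω) : ℝ × (ℕ → ℝ) × (ℕ → ℝ) :=
  (D₀ ω, (fun n => G n ω), fun n => H n ω)

lemma lindleyStep_iterate_queuePath (n : ℕ) (ω : Ω) :
    lindleyStep^[n] (queuePath D₀ G H ω) =
      (Delay D₀ G H n ω, (fun i => G (n + i) ω), fun i => H (n + i) ω) := by
  rw [lindleyStep_iterate]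
  rfl

@[simp] lemma Delay_zero : Delay D₀ G H 0 = D₀ := by
  funext ω
  simp [Delay]

lemma Delay_succ (n : ℕ) (ω : Ω) :
    Delay D₀ G H (n + 1) ω = max (Delay D₀ G H n ω - G n ω) 0 + H n ω :=
  delay_succ _ _ _ _

variable [MeasurableSpace Ω] {P : Measure Ω}

/-- The averages of a function of an i.i.d. sequence. -/
lemma ae_tendsto_average_of_iid {X : ℕ → Ω → ℝ} {f : ℝ → ℝ} (hf : Measurable f)
    (hX : iIndepFun X P) (hid : ∀ n, IdentDistrib (X n) (X 0) P P)
    (hint : Integrable (fun ω => f (X 0 ω)) P) :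
    ∀ᵐ ω ∂P, Tendsto (fun N : ℕ => (∑ n ∈ Finset.range N, f (X n ω)) / N) atTop
      (𝓝 (∫ ω, f (X 0 ω) ∂P)) :=
  strong_law_ae_real (fun n ω => f (X n ω)) hint
    (fun _ _ hij => (hX.indepFun hij).comp hf hf) (fun n => (hid n).comp hf)

namespace IsStationaryGIGI1

/-! ### Stationarity on the path space -/

section Basic

variable (hQ : IsStationaryGIGI1 P D₀ G H)
include hQ

lemma measurable_queuePath : Measurable (queuePath D₀ G H) :=
  hQ.measurable_D₀.prodMk ((measurable_pi_lambda _ hQ.measurable_G).prodMk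
    (measurable_pi_lambda _ hQ.measurable_H))

lemma measurable_Delay (n : ℕ) : Measurable (Delay D₀ G H n) :=
  (measurable_delay n).comp hQ.measurable_queuePath

lemma ae_nonneg : ∀ᵐ ω ∂P, 0 ≤ D₀ ω ∧ (∀ n, 0 ≤ G n ω) ∧ ∀ n, 0 ≤ H n ω := by
  filter_upwards [hQ.nonneg_D₀, ae_all_iff.2 hQ.nonneg_G, ae_all_iff.2 hQ.nonneg_H] with ω h1 h2 h3
  exact ⟨h1, h2, h3⟩

lemma mean_H_lt_mean_G : P[H 0] < P[G 0] := by
  have := hQ.stable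
  rwa [div_lt_one hQ.mean_G_pos] at this

lemma indepFun_D₀_head : IndepFun D₀ (fun ω => (G 0 ω, H 0 ω)) P :=
  hQ.indepFun_D₀.comp measurable_id
    (((measurable_pi_apply 0).comp measurable_fst).prodMk
      ((measurable_pi_apply 0).comp measurable_snd))

lemma indepFun_G_H_zero : IndepFun (G 0) (H 0) P :=
  hQ.indepFun_G_H.comp (measurable_pi_apply 0) (measurable_pi_apply 0)

lemma indepFun_D₀_G_zero : IndepFun D₀ (G 0) P :=
  hQ.indepFun_D₀_head.comp measurable_id measurable_fst

variable [IsProbabilityMeasure P]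

lemma map_queuePath : P.map (queuePath D₀ G H) = (P.map D₀).prod
    ((Measure.infinitePi fun _ => P.map (G 0)).prod
      (Measure.infinitePi fun _ => P.map (H 0))) := by
  have hG : P.map (fun ω n => G n ω) = Measure.infinitePi fun _ => P.map (G 0) := by
    rw [hQ.iIndepFun_G.map_fun_eq_infinitePi_map hQ.measurable_G]
    congr 1
    funext n
    exact (hQ.identDistrib_G n).map_eq
  have hH : P.map (fun ω n => H n ω) = Measure.infinitePi fun _ => P.map (H 0) := by
    rw [hQ.iIndepFun_H.map_fun_eq_infinitePi_map hQ.measurable_H]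
    congr 1
    funext n
    exact (hQ.identDistrib_H n).map_eq
  have mG : Measurable (fun ω n => G n ω) := measurable_pi_lambda _ hQ.measurable_G
  have mH : Measurable (fun ω n => H n ω) := measurable_pi_lambda _ hQ.measurable_H
  rw [← hG, ← hH, ← (indepFun_iff_map_prod_eq_prod_map_map mG.aemeasurable
    mH.aemeasurable).1 hQ.indepFun_G_H]
  exact (indepFun_iff_map_prod_eq_prod_map_map hQ.measurable_D₀.aemeasurable
    (mG.prodMk mH).aemeasurable).1 hQ.indepFun_D₀

lemma measurePreserving_step :
    MeasurePreserving lindleyStep (P.map (queuePath D₀ G H)) (P.map (queuePath D₀ G H)) := by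
  have := Measure.isProbabilityMeasure_map (μ := P) hQ.measurable_D₀.aemeasurable
  have := Measure.isProbabilityMeasure_map (μ := P) (hQ.measurable_G 0).aemeasurable
  have := Measure.isProbabilityMeasure_map (μ := P) (hQ.measurable_H 0).aemeasurable
  rw [hQ.map_queuePath]
  apply measurePreserving_lindleyStep
  have h1 := (indepFun_iff_map_prod_eq_prod_map_map (hQ.measurable_G 0).aemeasurable
    (hQ.measurable_H 0).aemeasurable).1 hQ.indepFun_G_H_zero
  have h2 := (indepFun_iff_map_prod_eq_prod_map_map hQ.measurable_D₀.aemeasurable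
    ((hQ.measurable_G 0).prodMk (hQ.measurable_H 0)).aemeasurable).1 hQ.indepFun_D₀_head
  have h3 := (hQ.stationary 1).map_eq
  rw [Delay_zero] at h3
  rw [← h1, ← h2, Measure.map_map (by fun_prop) (hQ.measurable_D₀.prodMk
    ((hQ.measurable_G 0).prodMk (hQ.measurable_H 0)))]
  conv_rhs => rw [← h3]
  congr 1
  funext ω
  simp [Delay_succ]

/-- A functional of the queue seen from packet `n` has the same law for all `n`. -/
lemma identDistrib_iterate {F : ℝ × (ℕ → ℝ) × (ℕ → ℝ) → ℝ} (hF : Measurable F) (n m : ℕ) :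
    IdentDistrib (fun ω => F (lindleyStep^[n] (queuePath D₀ G H ω)))
      (fun ω => F (lindleyStep^[m] (queuePath D₀ G H ω))) P P := by
  have hmap : ∀ k, P.map (fun ω => F (lindleyStep^[k] (queuePath D₀ G H ω)))
      = (P.map (queuePath D₀ G H)).map F := by
    intro k
    have hk := hQ.measurePreserving_step.iterate k
    conv_rhs => rw [← hk.map_eq]
    rw [Measure.map_map hF hk.measurable,
      Measure.map_map (hF.comp hk.measurable) hQ.measurable_queuePath]
    rfl
  have hmeas : ∀ k, Measurable (fun ω => F (lindleyStep^[k] (queuePath D₀ G H ω))) := fun k =>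
    hF.comp ((hQ.measurePreserving_step.iterate k).measurable.comp hQ.measurable_queuePath)
  exact ⟨(hmeas n).aemeasurable, (hmeas m).aemeasurable, by rw [hmap, hmap]⟩

/-- The maximal inequality for functionals of the queue. -/
lemma measure_exists_sum_gt_le {F : ℝ × (ℕ → ℝ) × (ℕ → ℝ) → ℝ} (hF : Measurable F)
    (hF0 : ∀ y, 0 ≤ F y) (hint : Integrable (fun ω => F (queuePath D₀ G H ω)) P) {l : ℝ}
    (hl : 0 < l) :
    P {ω | ∃ N : ℕ, l * N < ∑ n ∈ Finset.range N, F (lindleyStep^[n] (queuePath D₀ G H ω))}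
      ≤ ENNReal.ofReal ((∫ ω, F (queuePath D₀ G H ω) ∂P) / l) := by
  have hT := hQ.measurePreserving_step
  have hm := hQ.measurable_queuePath
  have := Measure.isProbabilityMeasure_map (μ := P) hm.aemeasurable
  have hint' : Integrable F (P.map (queuePath D₀ G H)) :=
    (integrable_map_measure hF.aestronglyMeasurable hm.aemeasurable).2 hint
  have := measure_exists_birkhoffSum_gt_le hT hF hint' hF0 hl
  rw [integral_map hm.aemeasurable hF.aestronglyMeasurable, Measure.map_apply hm] at this
  · exact this
  · have : {y | ∃ N : ℕ, l * N < birkhoffSum lindleyStep F N y}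
        = ⋃ N : ℕ, {y | l * N < birkhoffSum lindleyStep F N y} := by
      ext y; simp
    rw [this]
    refine MeasurableSet.iUnion fun N => measurableSet_lt measurable_const ?_
    exact Finset.measurable_sum _ fun k _ => hF.comp (hT.iterate k).measurable

end Basic

end IsStationaryGIGI1

end Stationary

lemma abs_Delay_sub_le {Ω : Type*} {D₀ : Ω → ℝ} {G H : ℕ → Ω → ℝ} (n : ℕ) (ω : Ω) :
    |Delay D₀ G H n ω - Delay (fun _ => 0) G H n ω| ≤ |D₀ ω| := by
  have := abs_delay_sub_le (d := D₀ ω) (d' := 0) (g := fun k => G k ω) (h := fun k => H k ω) n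
  rwa [sub_zero] at this

namespace IsStationaryGIGI1

variable {Ω : Type*} [MeasurableSpace Ω] {P : Measure Ω}
  {D₀ : Ω → ℝ} {G H : ℕ → Ω → ℝ}

/-! ### Law of large numbers for interarrival time times delay -/

section Approximation

variable (hQ : IsStationaryGIGI1 P D₀ G H)
include hQ

lemma ae_tendsto_sum_sub_atTop :
    ∀ᵐ ω ∂P, Tendsto (fun N : ℕ => ∑ n ∈ Finset.range N, (G n ω - H n ω)) atTop atTop := by
  filter_upwards [ae_tendsto_average_of_iid measurable_id hQ.iIndepFun_G hQ.identDistrib_G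
    hQ.integrable_G, ae_tendsto_average_of_iid measurable_id hQ.iIndepFun_H hQ.identDistrib_H
    hQ.integrable_H] with ω h1 h2
  refine tendsto_sum_atTop (sub_pos.2 hQ.mean_H_lt_mean_G) ((h1.sub h2).congr fun N => ?_)
  simp only [id, Finset.sum_sub_distrib, sub_div]

lemma integrable_G_mul_D₀ (hD : Integrable D₀ P) : Integrable (fun ω => G 0 ω * D₀ ω) P :=
  hQ.indepFun_D₀_G_zero.symm.integrable_mul hQ.integrable_G hD

lemma integrable_G_mul_H : Integrable (fun ω => G 0 ω * H 0 ω) P :=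
  hQ.indepFun_G_H_zero.integrable_mul hQ.integrable_G hQ.integrable_H

lemma measurable_Delay_empty (K : ℕ) : Measurable (Delay (fun _ => 0) G H K) :=
  (measurable_delay K).comp (measurable_const.prodMk
    ((measurable_pi_lambda _ hQ.measurable_G).prodMk (measurable_pi_lambda _ hQ.measurable_H)))

lemma integrable_G_mul_wait (hD : Integrable D₀ P) :
    Integrable (fun ω => G 0 ω * max (D₀ ω - G 0 ω) 0) P := by
  have h1 := hQ.measurable_G 0
  have h2 := hQ.measurable_D₀
  refine (hQ.integrable_G_mul_D₀ hD).mono (by fun_prop) ?_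
  filter_upwards [hQ.ae_nonneg] with ω hω
  have hg := hω.2.1 0
  rw [Real.norm_of_nonneg (mul_nonneg hg (le_max_right _ _)),
    Real.norm_of_nonneg (mul_nonneg hg hω.1)]
  exact mul_le_mul_of_nonneg_left (max_le (by linarith) hω.1) hg

lemma integrable_G_mul_Delay_one (hD : Integrable D₀ P) :
    Integrable (fun ω => G 0 ω * Delay D₀ G H 1 ω) P := by
  refine ((hQ.integrable_G_mul_wait hD).add hQ.integrable_G_mul_H).congr ?_
  filter_upwards with ω
  simp [Delay_succ, mul_add]

/-- The difference made by the initial delay to the delay of packet `K` vanishes in mean. -/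
lemma tendsto_integral_abs_delay_sub (hD : Integrable D₀ P) :
    Tendsto (fun K => ∫ ω, |Delay D₀ G H K ω - Delay (fun _ => 0) G H K ω| ∂P) atTop (𝓝 0) := by
  have hlim : ∀ᵐ ω ∂P, Tendsto (fun K => |Delay D₀ G H K ω - Delay (fun _ => 0) G H K ω|) atTop
      (𝓝 0) := by
    filter_upwards [hQ.ae_nonneg, hQ.ae_tendsto_sum_sub_atTop] with ω hω hω'
    refine tendsto_const_nhds.congr' ?_
    filter_upwards [eventually_delay_eq hω.1 hω.2.2 hω'] with K hK
    simp [Delay, hK]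
  have := tendsto_integral_of_dominated_convergence (fun ω => |D₀ ω|)
    (fun K => ((hQ.measurable_Delay K).sub (hQ.measurable_Delay_empty K)).abs.aestronglyMeasurable)
    hD.abs
    (fun K => ae_of_all _ fun ω => ?_) hlim
  · simpa using this
  · rw [Real.norm_eq_abs, abs_abs]
    exact abs_Delay_sub_le K ω

variable [IsProbabilityMeasure P]

lemma identDistrib_G_mul_Delay (n : ℕ) :
    IdentDistrib (fun ω => G n ω * Delay D₀ G H (n + 1) ω)
      (fun ω => G 0 ω * Delay D₀ G H 1 ω) P P := by
  have := hQ.identDistrib_iterate (F := fun y => y.2.1 0 * (max (y.1 - y.2.1 0) 0 + y.2.2 0))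
    (by fun_prop) n 0
  simpa only [lindleyStep_iterate_queuePath, add_zero, zero_add, Delay_succ] using this

/-- The interarrival time after packet `K` is independent of what happened before. -/
lemma indepFun_G_past (K : ℕ) :
    IndepFun (fun ω => (((fun i : Finset.range K => G i ω), fun n => H n ω), D₀ ω)) (G K) P := by
  have mG := hQ.measurable_G
  have mH : Measurable (fun ω n => H n ω) := measurable_pi_lambda _ hQ.measurable_H
  have mA : Measurable (fun ω (i : Finset.range K) => G i ω) :=
    measurable_pi_lambda _ fun i => mG i
  have h1 : IndepFun (fun ω (i : Finset.range K) => G i ω) (G K) P :=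
    (hQ.iIndepFun_G.indepFun_finset (Finset.range K) {K} (by simp) mG).comp measurable_id
      (measurable_pi_apply (⟨K, by simp⟩ : ({K} : Finset ℕ)))
  have h2 : IndepFun (fun ω => ((fun i : Finset.range K => G i ω), G K ω))
      (fun ω => ((fun n => H n ω), ())) P :=
    hQ.indepFun_G_H.comp
      (φ := fun g : ℕ → ℝ => ((fun i : Finset.range K => g i), g K)) (ψ := fun h => (h, ()))
      (by fun_prop) (by fun_prop)
  have h3 := (indepFun_prodMk_prodMk_of_indepFun mA (mG K) mH measurable_const h1
    (indepFun_const_right _ ()) h2).comp measurable_id measurable_fst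
  have h4 : IndepFun (fun ω => (((fun i : Finset.range K => G i ω), fun n => H n ω), G K ω))
      (fun ω => (D₀ ω, ())) P :=
    hQ.indepFun_D₀.symm.comp
      (φ := fun x : (ℕ → ℝ) × (ℕ → ℝ) => (((fun i : Finset.range K => x.1 i), x.2), x.1 K))
      (ψ := fun d => (d, ())) (by fun_prop) (by fun_prop)
  exact (indepFun_prodMk_prodMk_of_indepFun (mA.prodMk mH) (mG K) hQ.measurable_D₀ measurable_const
    h3 (indepFun_const_right _ ()) h4).comp measurable_id measurable_fst

/-- The delays of packet `K` involve only the interarrival times before `G K`, so the mean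
approximation error factors. -/
lemma integral_abs_G_mul_delay_sub (hD : Integrable D₀ P) (K : ℕ) :
    Integrable (fun ω => |G K ω * (Delay D₀ G H K ω - Delay (fun _ => 0) G H K ω)|) P ∧
    ∫ ω, |G K ω * (Delay D₀ G H K ω - Delay (fun _ => 0) G H K ω)| ∂P
      = (∫ ω, |G 0 ω| ∂P) * ∫ ω, |Delay D₀ G H K ω - Delay (fun _ => 0) G H K ω| ∂P := by
  have hm0 := hQ.measurable_Delay_empty K
  have hfac : IndepFun (fun ω => |Delay D₀ G H K ω - Delay (fun _ => 0) G H K ω|)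
      (fun ω => |G K ω|) P := by
    have hext := measurable_extendZero (Finset.range K)
    set ψ : ((Finset.range K → ℝ) × (ℕ → ℝ)) × ℝ → ℝ := fun x =>
      |delay x.2 (extendZero (Finset.range K) x.1.1) x.1.2 K
        - delay 0 (extendZero (Finset.range K) x.1.1) x.1.2 K| with hψ
    have m1 : Measurable fun x : ((Finset.range K → ℝ) × (ℕ → ℝ)) × ℝ =>
        (extendZero (Finset.range K) x.1.1, x.1.2) :=
      (hext.comp (measurable_fst.comp measurable_fst)).prodMk (measurable_snd.comp measurable_fst)
    have mψ : Measurable ψ := (((measurable_delay K).comp (measurable_snd.prodMk m1)).sub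
      ((measurable_delay K).comp (measurable_const.prodMk m1))).abs
    have := (hQ.indepFun_G_past K).comp mψ measurable_abs
    refine this.congr (ae_of_all _ fun ω => ?_) (ae_of_all _ fun ω => rfl)
    have h1 : ∀ d, delay d (extendZero (Finset.range K) fun i => G i ω) (fun n => H n ω) K
        = delay d (fun n => G n ω) (fun n => H n ω) K := fun d =>
      delay_congr (fun i hi => extendZero_of_mem (Finset.mem_range.2 hi) fun n => G n ω)
        (fun _ _ => rfl)
    simp only [Function.comp, hψ, h1]
    rfl
  have hΔ : Integrable (fun ω => |Delay D₀ G H K ω - Delay (fun _ => 0) G H K ω|) P := by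
    refine hD.mono ((hQ.measurable_Delay K).sub hm0).abs.aestronglyMeasurable ?_
    filter_upwards with ω
    rw [Real.norm_eq_abs, abs_abs, Real.norm_eq_abs]
    exact abs_Delay_sub_le K ω
  have hGK : Integrable (fun ω => |G K ω|) P :=
    ((hQ.identDistrib_G K).integrable_iff.2 hQ.integrable_G).abs
  have hGid : ∫ ω, |G K ω| ∂P = ∫ ω, |G 0 ω| ∂P :=
    ((hQ.identDistrib_G K).comp measurable_abs).integral_eq
  simp only [abs_mul]
  refine ⟨hfac.symm.integrable_mul hGK hΔ, ?_⟩
  rw [← hGid]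
  exact hfac.symm.integral_mul_eq_mul_integral hGK.aestronglyMeasurable hΔ.aestronglyMeasurable

/-- The truncated chain, restarted empty `K` packets earlier, has convergent averages: it is a
stationary process with finite-range dependence. -/
lemma ae_tendsto_average_truncated (K : ℕ)
    (hint : Integrable (fun ω => G K ω * Delay (fun _ => 0) G H (K + 1) ω) P) :
    ∀ᵐ ω ∂P, Tendsto (fun N : ℕ => (∑ n ∈ Finset.range N, G (n + K) ω
      * delay 0 (fun i => G (n + i) ω) (fun i => H (n + i) ω) (K + 1)) / N) atTop
      (𝓝 (∫ ω, G K ω * Delay (fun _ => 0) G H (K + 1) ω ∂P)) := by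
  set q : ℕ → Ω → ℝ := fun n ω => G (n + K) ω
      * delay 0 (fun i => G (n + i) ω) (fun i => H (n + i) ω) (K + 1) with hq
  have hq0 : (fun ω => G K ω * Delay (fun _ => 0) G H (K + 1) ω) = q 0 := by
    funext ω
    simp [hq, Delay]
  rw [hq0] at hint ⊢
  have hid : ∀ n m, IdentDistrib (q n) (q m) P P := by
    intro n m
    have := hQ.identDistrib_iterate (F := fun y => y.2.1 K * delay 0 y.2.1 y.2.2 (K + 1))
      (((measurable_pi_apply K).comp (measurable_fst.comp measurable_snd)).mul
        ((measurable_delay (K + 1)).comp (measurable_const.prodMk measurable_snd))) n m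
    simpa only [lindleyStep_iterate_queuePath] using this
  -- `q n` is a function of the inputs with index in [n, n + K], and these windows are disjoint.
  have hindep : ∀ n m, n + (K + 1) ≤ m → IndepFun (q n) (q m) P := by
    intro n m hnm
    set S : ℕ → Finset ℕ := fun k => Finset.Ico k (k + (K + 1)) with hS
    have hdisj : Disjoint (S n) (S m) := by
      rw [Finset.disjoint_left]
      intro i hi hi'
      simp only [hS, Finset.mem_Ico] at hi hi'
      omega
    have mG : ∀ k, Measurable (fun ω (i : S k) => G i ω) := fun k =>
      measurable_pi_lambda _ fun i => hQ.measurable_G i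
    have mH : ∀ k, Measurable (fun ω (i : S k) => H i ω) := fun k =>
      measurable_pi_lambda _ fun i => hQ.measurable_H i
    have hblock := indepFun_prodMk_prodMk_of_indepFun (mG n) (mG m) (mH n) (mH m)
      (hQ.iIndepFun_G.indepFun_finset (S n) (S m) hdisj hQ.measurable_G)
      (hQ.iIndepFun_H.indepFun_finset (S n) (S m) hdisj hQ.measurable_H)
      (hQ.indepFun_G_H.comp
        (φ := fun g : ℕ → ℝ => ((fun i : S n => g i), (fun i : S m => g i)))
        (ψ := fun g : ℕ → ℝ => ((fun i : S n => g i), (fun i : S m => g i)))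
        (by fun_prop) (by fun_prop))
    set ψ : (k : ℕ) → (S k → ℝ) × (S k → ℝ) → ℝ := fun k x => extendZero (S k) x.1 (k + K)
      * delay 0 (fun i => extendZero (S k) x.1 (k + i)) (fun i => extendZero (S k) x.2 (k + i))
        (K + 1) with hψ
    have mψ : ∀ k, Measurable (ψ k) := by
      intro k
      have m1 : Measurable fun x : (S k → ℝ) × (S k → ℝ) => extendZero (S k) x.1 :=
        (measurable_extendZero (S k)).comp measurable_fst
      have m2 : Measurable fun x : (S k → ℝ) × (S k → ℝ) => extendZero (S k) x.2 :=
        (measurable_extendZero (S k)).comp measurable_snd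
      refine ((measurable_pi_apply (k + K)).comp m1).mul ((measurable_delay (K + 1)).comp
        (measurable_const.prodMk ((measurable_pi_lambda _ fun i => ?_).prodMk
          (measurable_pi_lambda _ fun i => ?_))))
      · exact (measurable_pi_apply (k + i)).comp m1
      · exact (measurable_pi_apply (k + i)).comp m2
    have hqψ : ∀ k ω, ψ k ((fun i : S k => G i ω), (fun i : S k => H i ω)) = q k ω := by
      intro k ω
      have hmem : ∀ i < K + 1, k + i ∈ S k := fun i hi => by simp only [hS, Finset.mem_Ico]; omega
      simp only [hψ, hq]
      congr 1
      · exact extendZero_of_mem (hmem K (by omega)) fun n => G n ω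
      · exact delay_congr (fun i hi => extendZero_of_mem (hmem i hi) fun n => G n ω)
          (fun i hi => extendZero_of_mem (hmem i hi) fun n => H n ω)
    have := hblock.comp (mψ n) (mψ m)
    exact this.congr (ae_of_all _ fun ω => hqψ n ω) (ae_of_all _ fun ω => hqψ m ω)
  have hres : ∀ r : ℕ, ∀ᵐ ω ∂P, Tendsto
      (fun N : ℕ => (∑ j ∈ Finset.range N, q (r + j * (K + 1)) ω) / N) atTop
      (𝓝 (∫ ω, q 0 ω ∂P)) := by
    intro r
    have := strong_law_ae_real (μ := P) (fun j => q (r + j * (K + 1)))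
      ((hid _ 0).integrable_iff.2 hint) ?_ (fun j => hid _ _)
    · rwa [(hid (r + 0 * (K + 1)) 0).integral_eq] at this
    · intro i j hij
      have key : ∀ i j : ℕ, i < j → IndepFun (q (r + i * (K + 1))) (q (r + j * (K + 1))) P := by
        intro i j hij
        refine hindep _ _ ?_
        have := Nat.mul_le_mul_right (K + 1) (Nat.succ_le_of_lt hij)
        rw [Nat.succ_mul] at this
        omega
      rcases lt_or_gt_of_ne hij with h | h
      · exact key i j h
      · exact (key j i h).symm
  filter_upwards [ae_all_iff.2 hres] with ω hω
  exact tendsto_average_of_residues (Nat.succ_pos K) fun r _ => hω r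

/-- The law of large numbers for the products of interarrival times and delays. -/
theorem ae_tendsto_average_G_mul_Delay (hD : Integrable D₀ P) :
    ∀ᵐ ω ∂P, Tendsto (fun N : ℕ =>
      (∑ n ∈ Finset.range N, G n ω * Delay D₀ G H (n + 1) ω) / N) atTop
      (𝓝 (∫ ω, G 0 ω * Delay D₀ G H 1 ω ∂P)) := by
  refine ae_tendsto_average_of_approx (p := fun n ω => G n ω * Delay D₀ G H (n + 1) ω)
    fun ε hε => ?_
  obtain ⟨K, hK⟩ : ∃ K, (∫ ω, |G 0 ω| ∂P)
      * ∫ ω, |Delay D₀ G H K ω - Delay (fun _ => 0) G H K ω| ∂P ≤ ε := by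
    have := (hQ.tendsto_integral_abs_delay_sub hD).const_mul (∫ ω, |G 0 ω| ∂P)
    rw [mul_zero] at this
    exact ((this.eventually_lt_const hε).mono fun _ h => h.le).exists
  obtain ⟨hui, hueq⟩ := hQ.integral_abs_G_mul_delay_sub hD K
  have hm0 := hQ.measurable_Delay_empty (K + 1)
  have hdiff : ∀ ω, |G K ω * Delay D₀ G H (K + 1) ω - G K ω * Delay (fun _ => 0) G H (K + 1) ω|
      ≤ |G K ω * (Delay D₀ G H K ω - Delay (fun _ => 0) G H K ω)| := by
    intro ω
    rw [← mul_sub, abs_mul, abs_mul]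
    exact mul_le_mul_of_nonneg_left (abs_delay_succ_sub_le K) (abs_nonneg _)
  have hpK : Integrable (fun ω => G K ω * Delay D₀ G H (K + 1) ω) P :=
    (hQ.identDistrib_G_mul_Delay K).integrable_iff.2 (hQ.integrable_G_mul_Delay_one hD)
  have hdint : Integrable (fun ω => G K ω * Delay D₀ G H (K + 1) ω
      - G K ω * Delay (fun _ => 0) G H (K + 1) ω) P :=
    hui.mono (((hQ.measurable_G K).mul (hQ.measurable_Delay (K + 1))).sub
      ((hQ.measurable_G K).mul hm0)).aestronglyMeasurable
      (ae_of_all _ fun ω => by simpa using hdiff ω)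
  have hqint : Integrable (fun ω => G K ω * Delay (fun _ => 0) G H (K + 1) ω) P := by
    refine (hpK.sub hdint).congr (ae_of_all _ fun ω => ?_)
    simp
  -- The error bound uses the delays after `K` steps instead of `K + 1`: the last step is a
  -- contraction, and the earlier delays are independent of `G (n + K)`.
  refine ⟨K, _, fun n ω => |G (n + K) ω * (delay (Delay D₀ G H n ω) (fun i => G (n + i) ω)
      (fun i => H (n + i) ω) K - delay 0 (fun i => G (n + i) ω) (fun i => H (n + i) ω) K)|, _, ?_,
    hQ.ae_tendsto_average_truncated K hqint, ae_of_all _ fun ω n => ?_, fun l hl => ?_⟩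
  · rw [← (hQ.identDistrib_G_mul_Delay K).integral_eq, abs_sub_comm, ← integral_sub hpK hqint]
    refine (abs_integral_le_integral_abs).trans (le_trans ?_ hK)
    rw [← hueq]
    exact integral_mono hdint.abs hui hdiff
  · have h1 : Delay D₀ G H (n + K + 1) ω = delay (Delay D₀ G H n ω) (fun i => G (n + i) ω)
        (fun i => H (n + i) ω) (K + 1) := delay_add _ _ _ n (K + 1)
    beta_reduce
    rw [h1, ← mul_sub, abs_mul, abs_mul]
    exact mul_le_mul_of_nonneg_left (abs_delay_succ_sub_le K) (abs_nonneg _)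
  · set F : ℝ × (ℕ → ℝ) × (ℕ → ℝ) → ℝ := fun y =>
      |y.2.1 K * (delay y.1 y.2.1 y.2.2 K - delay 0 y.2.1 y.2.2 K)| with hF
    have mF : Measurable F :=
      (((measurable_pi_apply K).comp (measurable_fst.comp measurable_snd)).mul
        ((measurable_delay K).sub
          ((measurable_delay K).comp (measurable_const.prodMk measurable_snd)))).abs
    have := hQ.measure_exists_sum_gt_le mF (fun _ => abs_nonneg _) hui hl
    simp only [lindleyStep_iterate_queuePath] at this
    refine this.trans (ENNReal.ofReal_le_ofReal ?_)
    gcongr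
    exact hueq.trans_le hK

end Approximation

end IsStationaryGIGI1

namespace IsStationaryGIGI1

variable {Ω : Type*} [MeasurableSpace Ω] {P : Measure Ω} {D₀ : Ω → ℝ} {G H : ℕ → Ω → ℝ}

/-! ### Covariance bounds -/

section Covariance

variable (hQ : IsStationaryGIGI1 P D₀ G H)
include hQ

lemma integral_Delay (n : ℕ) : ∫ ω, Delay D₀ G H n ω ∂P = ∫ ω, D₀ ω ∂P := by
  rw [(hQ.stationary n).integral_eq, Delay_zero]

lemma integrable_Delay (hD : Integrable D₀ P) (n : ℕ) : Integrable (Delay D₀ G H n) P := by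
  rw [(hQ.stationary n).integrable_iff, Delay_zero]
  exact hD

/-- The covariance only involves the waiting time. -/
lemma integral_G_mul_Delay_sub (hD : Integrable D₀ P) :
    ∫ ω, G 0 ω * Delay D₀ G H 1 ω ∂P - P[G 0] * P[D₀]
      = ∫ ω, (G 0 ω - P[G 0]) * max (D₀ ω - G 0 ω) 0 ∂P := by
  have mG := hQ.measurable_G 0
  have mD := hQ.measurable_D₀
  have hGW := hQ.integrable_G_mul_wait hD
  have hGH := hQ.integrable_G_mul_H
  have hW : Integrable (fun ω => max (D₀ ω - G 0 ω) 0) P :=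
    (hD.sub hQ.integrable_G).sup (integrable_zero _ _ _)
  have hE : ∫ ω, G 0 ω * H 0 ω ∂P = P[G 0] * P[H 0] :=
    hQ.indepFun_G_H_zero.integral_mul_eq_mul_integral mG.aestronglyMeasurable
      (hQ.measurable_H 0).aestronglyMeasurable
  rw [← hQ.integral_Delay 1]
  simp only [Delay_succ, Delay_zero, mul_add, sub_mul]
  rw [integral_add hGW hGH, integral_add hW hQ.integrable_H, integral_sub hGW (hW.const_mul _),
    integral_const_mul, hE]
  ring

variable [IsProbabilityMeasure P]

/-- Expanded from the definition, since the delay need not be square integrable. -/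
lemma covariance_G_Delay (hD : Integrable D₀ P) (n : ℕ) :
    cov[G n, Delay D₀ G H (n + 1); P] =
      ∫ ω, G 0 ω * Delay D₀ G H 1 ω ∂P - P[G 0] * P[D₀] := by
  have hG : Integrable (G n) P := (hQ.identDistrib_G n).integrable_iff.2 hQ.integrable_G
  have hW := hQ.integrable_Delay hD (n + 1)
  have hGW : Integrable (fun ω => G n ω * Delay D₀ G H (n + 1) ω) P :=
    (hQ.identDistrib_G_mul_Delay n).integrable_iff.2 (hQ.integrable_G_mul_Delay_one hD)
  rw [covariance, (hQ.identDistrib_G n).integral_eq, hQ.integral_Delay,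
    ← (hQ.identDistrib_G_mul_Delay n).integral_eq]
  have hexp : ∀ ω, (G n ω - P[G 0]) * (Delay D₀ G H (n + 1) ω - ∫ ω, D₀ ω ∂P)
      = G n ω * Delay D₀ G H (n + 1) ω - G n ω * (∫ ω, D₀ ω ∂P)
        - (P[G 0] * Delay D₀ G H (n + 1) ω - P[G 0] * ∫ ω, D₀ ω ∂P) := fun ω => by ring
  simp_rw [hexp]
  have h1 : Integrable (fun ω => G n ω * Delay D₀ G H (n + 1) ω - G n ω * ∫ ω, D₀ ω ∂P) P :=
    hGW.sub (hG.mul_const _)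
  have h2 : Integrable (fun ω => P[G 0] * Delay D₀ G H (n + 1) ω - P[G 0] * ∫ ω, D₀ ω ∂P) P :=
    (hW.const_mul _).sub (integrable_const _)
  rw [integral_sub h1 h2,
    integral_sub hGW (hG.mul_const _), integral_sub (hW.const_mul _) (integrable_const _),
    integral_mul_const, integral_const_mul, hQ.integral_Delay, (hQ.identDistrib_G n).integral_eq]
  simp

/-- Replacing max(D₀ - G, 0) by max(D₀ - m, 0) can only increase the integrand, whichever side of m
the value of G lies on; by independence the new integral is zero. -/
lemma integral_sub_mul_wait_nonpos (hD : Integrable D₀ P) :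
    ∫ ω, (G 0 ω - P[G 0]) * max (D₀ ω - G 0 ω) 0 ∂P ≤ 0 := by
  set m := P[G 0] with hm
  have hGm : Integrable (fun ω => G 0 ω - m) P := hQ.integrable_G.sub (integrable_const _)
  have hDm : Integrable (fun ω => max (D₀ ω - m) 0) P :=
    (hD.sub (integrable_const _)).sup (integrable_zero _ _ _)
  have hind : IndepFun (fun ω => G 0 ω - m) (fun ω => max (D₀ ω - m) 0) P :=
    hQ.indepFun_D₀_G_zero.symm.comp (φ := fun x => x - m) (ψ := fun x => max (x - m) 0)
      (by fun_prop) (by fun_prop)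
  have hW : Integrable (fun ω => max (D₀ ω - G 0 ω) 0) P :=
    (hD.sub hQ.integrable_G).sup (integrable_zero _ _ _)
  have hzero : ∫ ω, (G 0 ω - m) * max (D₀ ω - m) 0 ∂P = 0 := by
    have h1 : ∫ ω, (G 0 ω - m) * max (D₀ ω - m) 0 ∂P
        = (∫ ω, (G 0 ω - m) ∂P) * ∫ ω, max (D₀ ω - m) 0 ∂P :=
      hind.integral_mul_eq_mul_integral hGm.aestronglyMeasurable hDm.aestronglyMeasurable
    rw [h1, integral_sub hQ.integrable_G (integrable_const _)]
    simp [hm]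
  refine le_of_le_of_eq (integral_mono ?_ (hind.integrable_mul hGm hDm) fun ω => ?_) hzero
  · simp only [sub_mul]
    exact (hQ.integrable_G_mul_wait hD).sub (hW.const_mul _)
  · rcases le_total m (G 0 ω) with h | h
    · exact mul_le_mul_of_nonneg_left (max_le_max_right 0 (sub_le_sub_left h _)) (by linarith)
    · exact mul_le_mul_of_nonpos_left (max_le_max_right 0 (sub_le_sub_left h _)) (by linarith)

/-- The integrand is nonnegative where G ≥ m, and at least -m D₀ where G < m, as 0 ≤ G and the wait
is at most D₀; independence then splits the mean of D₀ over {G < m}. -/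
lemma le_integral_sub_mul_wait (hD : Integrable D₀ P) :
    -(P[G 0] * P[D₀] * P.real {ω | G 0 ω < P[G 0]}) ≤
      ∫ ω, (G 0 ω - P[G 0]) * max (D₀ ω - G 0 ω) 0 ∂P := by
  set m := P[G 0] with hm
  have mG := hQ.measurable_G 0
  have hE : MeasurableSet {ω | G 0 ω < m} := measurableSet_lt mG measurable_const
  set f : ℝ → ℝ := (Set.Iio m).indicator fun _ => 1 with hf
  have mf : Measurable f := measurable_const.indicator measurableSet_Iio
  have hfG : (fun ω => f (G 0 ω)) = {ω | G 0 ω < m}.indicator fun _ => 1 := by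
    funext ω
    simp [hf, Set.indicator_apply]
  have hfint : Integrable (fun ω => f (G 0 ω)) P := by
    rw [hfG]
    exact (integrable_const 1).indicator hE
  have hind : IndepFun D₀ (fun ω => f (G 0 ω)) P :=
    hQ.indepFun_D₀_G_zero.comp measurable_id mf
  have hW : Integrable (fun ω => max (D₀ ω - G 0 ω) 0) P :=
    (hD.sub hQ.integrable_G).sup (integrable_zero _ _ _)
  have hval : ∫ ω, -m * (D₀ ω * f (G 0 ω)) ∂P = -(m * P[D₀] * P.real {ω | G 0 ω < m}) := by
    have h1 : ∫ ω, D₀ ω * f (G 0 ω) ∂P = (∫ ω, D₀ ω ∂P) * ∫ ω, f (G 0 ω) ∂P :=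
      hind.integral_mul_eq_mul_integral hD.aestronglyMeasurable hfint.aestronglyMeasurable
    have h2 : ∫ ω, f (G 0 ω) ∂P = P.real {ω | G 0 ω < m} := by
      rw [hfG]
      exact integral_indicator_one hE
    rw [integral_const_mul, h1, h2]
    ring
  rw [← hval]
  refine integral_mono_ae ((hind.integrable_mul hD hfint).const_mul _) ?_ ?_
  · simp only [sub_mul]
    exact (hQ.integrable_G_mul_wait hD).sub (hW.const_mul _)
  · filter_upwards [hQ.ae_nonneg] with ω hω
    have hg := hω.2.1 0
    have hw : 0 ≤ max (D₀ ω - G 0 ω) 0 := le_max_right _ _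
    have hwD : max (D₀ ω - G 0 ω) 0 ≤ D₀ ω := max_le (by linarith) hω.1
    by_cases h : G 0 ω < m
    · have : f (G 0 ω) = 1 := by simp [hf, h]
      rw [this]
      nlinarith [hω.1]
    · have : f (G 0 ω) = 0 := by simp [hf, not_lt.1 h]
      rw [this, mul_zero, mul_zero]
      exact mul_nonneg (by linarith [not_lt.1 h]) hw

end Covariance

/-- The mean age of information in a stationary GI/GI/1 queue. -/
theorem isMeanAge [IsProbabilityMeasure P] (hQ : IsStationaryGIGI1 P D₀ G H) (hG : MemLp (G 0) 2 P)
    (hD : Integrable D₀ P) :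
    IsMeanAge P D₀ G H
      (((∫ ω, G 0 ω ^ 2 ∂P) / 2 + ∫ ω, G 0 ω * Delay D₀ G H 1 ω ∂P) / P[G 0]) := by
  filter_upwards [hQ.ae_nonneg, hQ.ae_tendsto_average_G_mul_Delay hD,
    ae_tendsto_average_of_iid measurable_id hQ.iIndepFun_G hQ.identDistrib_G hQ.integrable_G,
    ae_tendsto_average_of_iid (f := fun x => x ^ 2) (by fun_prop) hQ.iIndepFun_G
      hQ.identDistrib_G hG.integrable_sq] with ω hω h3 h1 h2
  exact tendsto_average_age hω.1 hω.2.1 hω.2.2 hQ.mean_G_pos h1 h2 h3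

end IsStationaryGIGI1

lemma half_one_add_coeffVar_sq_mul {Ω : Type*} [MeasurableSpace Ω] {P : Measure Ω}
    [IsProbabilityMeasure P] {X : Ω → ℝ} (hX : MemLp X 2 P) (hpos : 0 < P[X]) :
    (1 + coeffVar P X ^ 2) / 2 * P[X] = (∫ ω, X ω ^ 2 ∂P) / 2 / P[X] := by
  have hvar : Var[X; P] = (∫ ω, X ω ^ 2 ∂P) - P[X] ^ 2 := variance_eq_sub hX
  rw [coeffVar, div_pow, Real.sq_sqrt (variance_nonneg _ _), hvar]
  field_simp
  ring

end AgeOfInformation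

open AgeOfInformation in
theorem theorem5 {Ω : Type*} [MeasurableSpace Ω] (P : Measure Ω) [IsProbabilityMeasure P]
    (D₀ : Ω → ℝ) (G H : ℕ → Ω → ℝ) (hQ : IsStationaryGIGI1 P D₀ G H)
    (hG : MemLp (G 0) 2 P) (hD : Integrable (Delay D₀ G H 0) P) :
    (∃ EA : ℝ, IsMeanAge P D₀ G H EA ∧
      P[Delay D₀ G H 0] * P.real {ω | P[G 0] ≤ G 0 ω}
          + (1 + coeffVar P (G 0) ^ 2) / 2 * P[G 0] ≤ EA ∧
      EA ≤ P[Delay D₀ G H 0] + (1 + coeffVar P (G 0) ^ 2) / 2 * P[G 0]) ∧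
    (∀ n : ℕ, Integrable (fun ω => G n ω * Delay D₀ G H (n + 1) ω) P ∧
      -(P[G 0] * P[Delay D₀ G H 0] * P.real {ω | G 0 ω < P[G 0]})
          ≤ cov[G n, Delay D₀ G H (n + 1); P] ∧
      cov[G n, Delay D₀ G H (n + 1); P] ≤ 0) := by
  rw [Delay_zero] at hD ⊢
  have hpos := hQ.mean_G_pos
  have hlow := hQ.le_integral_sub_mul_wait hD
  have hupp := hQ.integral_sub_mul_wait_nonpos hD
  rw [← hQ.integral_G_mul_Delay_sub hD] at hlow hupp
  refine ⟨⟨_, hQ.isMeanAge hG hD, ?_, ?_⟩, fun n => ⟨?_, ?_, ?_⟩⟩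
  -- Once the common term E[G²]/(2E[G]) is removed, the claim is the lower covariance bound divided
  -- by E[G].
  · have hcompl : P.real {ω | P[G 0] ≤ G 0 ω} = 1 - P.real {ω | G 0 ω < P[G 0]} := by
      rw [← probReal_compl_eq_one_sub (measurableSet_lt (hQ.measurable_G 0) measurable_const)]
      congr 1
      ext ω
      simp
    rw [half_one_add_coeffVar_sq_mul hG hpos, hcompl, add_div, add_comm]
    gcongr
    rw [le_div_iff₀ hpos]
    linarith
  · rw [half_one_add_coeffVar_sq_mul hG hpos, add_div, add_comm]
    gcongr
    rw [div_le_iff₀ hpos]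
    linarith
  · exact (hQ.identDistrib_G_mul_Delay n).integrable_iff.2 (hQ.integrable_G_mul_Delay_one hD)
  · rw [hQ.covariance_G_Delay hD]
    exact hlow
  · rw [hQ.covariance_G_Delay hD]
    exact hupp
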